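/- Let $a,b\in\mathbb R\setminus\{0\}$ and $0<\alpha,\beta\le 1$. For $s>0$ let $D^{\gamma}f(s)=\lim_{\varepsilon\to0}\frac{f(s+\varepsilon s^{1-\gamma})-f(s)}{\varepsilon}$ be the conformable fractional derivative, write $u_t^{(\beta)}$, $u_x^{(\alpha)}$ for the corresponding partial derivatives and $u_x^{(2\alpha)}=(u_x^{(\alpha)})_x^{(\alpha)}$, and consider, for $t,x>0$, the fractional Burgers equation $$\Delta:=u_t^{(\beta)}+a\,u\,u_x^{(\alpha)}+b\,u_x^{(2\alpha)}=0 .$$ Let $\Omega\subseteq\{(t,x,u): t>0,\ x>0\}$ be a non-empty connected open set. A $C^\infty$ vector field $V=\xi\,\partial_x+\tau\,\partial_t+\eta\,\partial_u$ on $\Omega$ (coefficients depending on $t,x,u$) is called an (infinitesimal) Lie point symmetry of the equation if it satisfies Lie's criterion $\mathrm{pr}^{(2\alpha,\beta)}V(\Delta)=0$ wherever $\Delta=0$, where $$\mathrm{pr}^{(2\alpha,\beta)}V=V+\eta^t_\beta\,\partial_{u_t^{(\beta)}}+\eta^x_\alpha\,\partial_{u_x^{(\alpha)}}+\eta^{xx}_\alpha\,\partial_{u_x^{(2\alpha)}},$$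 $$\eta^t_\beta=t^{1-\beta}\eta^t+(1-\beta)\tau t^{-\beta}u_t,\qquad \eta^x_\alpha=x^{1-\alpha}\eta^x+(1-\alpha)\xi x^{-\alpha}u_x,$$ $$\eta^{xx}_\alpha=x^{2-2\alpha}\eta^{xx}+(1-\alpha)x^{1-2\alpha}\eta^x+(2-2\alpha)x^{1-2\alpha}\xi u_{xx}+(1-\alpha)(1-2\alpha)x^{-2\alpha}\xi u_x,$$ and, with the total derivatives $D_t,D_x$, $\eta^t=D_t\eta-u_xD_t\xi-u_tD_t\tau$, $\eta^x=D_x\eta-u_xD_x\xi-u_tD_x\tau$, $\eta^{xx}=D_x\eta^x-u_{xx}D_x\xi-u_{xt}D_x\tau$. Then: 1. $V$ is a Lie point symmetry if and only if there are constants $c_1,\dots,c_5\in\mathbb R$ such that on $\Omega$ $$\tau=\frac{c_1t^{1+\beta}}{\beta^2}-\frac{2c_2t}{\beta}+c_4t^{1-\beta},\qquad \xi=\frac{c_1xt^\beta}{\alpha\beta}-\frac{c_2x}{\alpha}+\frac{ac_3}{\beta}t^\beta x^{1-\alpha}+c_5x^{1-\alpha},$$ $$\eta=\Big(-\frac{c_1t^\beta}{\beta}+c_2\Big)u+\frac{c_1x^\alpha}{a\alpha}+c_3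 .$$ 2. The Lie point symmetries on $\Omega$ form a five-dimensional real Lie algebra (closed under $[V,W]=VW-WV$) with basis $$V_1=t^{1-\beta}\partial_t,\quad V_2=x^{1-\alpha}\partial_x,\quad V_3=\frac{at^\beta x^{1-\alpha}}{\beta}\partial_x+\partial_u,\quad V_4=-\frac{2t}{\beta}\partial_t-\frac{x}{\alpha}\partial_x+u\,\partial_u,$$ $$V_5=\frac{t^{1+\beta}}{\beta^2}\partial_t+\frac{xt^\beta}{\alpha\beta}\partial_x+\Big(-\frac{t^\beta u}{\beta}+\frac{x^\alpha}{a\alpha}\Big)\partial_u .$$ 3. $[V_1,V_2]=[V_2,V_3]=[V_3,V_5]=0$, $[V_2,V_4]=-V_2$, $[V_2,V_5]=\frac1aV_3$, $[V_1,V_3]=aV_2$, $[V_1,V_4]=-2V_1$, $[V_1,V_5]=-V_4$, $[V_3,V_4]=V_3$, $[V_4,V_5]=-2V_5$. 4. If $\alpha=\beta=1$, the Lie point symmetries in the above sense are exactly the Lie point symmetries (with the ordinary second prolongation) of the classical Burgers equation $u_t+auu_x+bu_{xx}=0$ on $\Omega$, and $V_1,\dots,V_5$ become the classical fields $\partial_t$,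 $\partial_x$, $at\,\partial_x+\partial_u$, $-2t\,\partial_t-x\,\partial_x+u\,\partial_u$, $t^2\partial_t+xt\,\partial_x+(-tu+x/a)\partial_u$. -/

import Mathlib

open scoped ContDiff

noncomputable section

/-- The conformable fractional derivative of order `α` at `t > 0`,
`lim_{ε → 0} (f (t + ε t^(1-α)) - f t) / ε`: the limit is that of a difference quotient, i.e. it is
the derivative at `ε = 0` of `ε ↦ f (t + ε t^(1-α))`. Only points `t > 0` are used below. -/
def conformableDeriv (α : ℝ) (f : ℝ → ℝ) (t : ℝ) : ℝ :=
  deriv (fun ε : ℝ => f (t + ε * t ^ (1 - α))) 0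

/-- Classical partial derivative in `t` of `g = g(t,x)`. For a function `g(t,x) = h(t,x,u(t,x))`
this is the total derivative `D_t h` evaluated along `u`. -/
def partialT (g : ℝ → ℝ → ℝ) : ℝ → ℝ → ℝ := fun t x => deriv (fun s => g s x) t

/-- Classical partial derivative in `x` of `g = g(t,x)`. For a function `g(t,x) = h(t,x,u(t,x),…)`
this is the total derivative `D_x h` evaluated along `u`. -/
def partialX (g : ℝ → ℝ → ℝ) : ℝ → ℝ → ℝ := fun t x => deriv (fun y => g t y) x

/-- Conformable partial derivative `∂^β g / ∂t^β`. -/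
def fracPartialT (β : ℝ) (g : ℝ → ℝ → ℝ) : ℝ → ℝ → ℝ :=
  fun t x => conformableDeriv β (fun s => g s x) t

/-- Conformable partial derivative `∂^α g / ∂x^α`. -/
def fracPartialX (α : ℝ) (g : ℝ → ℝ → ℝ) : ℝ → ℝ → ℝ :=
  fun t x => conformableDeriv α (fun y => g t y) x

/-- A vector field `τ ∂_t + ξ ∂_x + η ∂_u` on the space of the variables `(t,x,u)`, written as
the map `(t,x,u) ↦ (τ, ξ, η)`. -/
abbrev PointField : Type := ℝ × ℝ × ℝ → ℝ × ℝ × ℝ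

/-- The coefficient `τ` of `V`, along the graph of `u`. -/
def tauAlong (V : PointField) (u : ℝ → ℝ → ℝ) : ℝ → ℝ → ℝ := fun t x => (V (t, x, u t x)).1

/-- The coefficient `ξ` of `V`, along the graph of `u`. -/
def xiAlong (V : PointField) (u : ℝ → ℝ → ℝ) : ℝ → ℝ → ℝ := fun t x => (V (t, x, u t x)).2.1

/-- The coefficient `η` of `V`, along the graph of `u`. -/
def etaAlong (V : PointField) (u : ℝ → ℝ → ℝ) : ℝ → ℝ → ℝ := fun t x => (V (t, x, u t x)).2.2

/-- `η^t = D_t η - u_x D_t ξ - u_t D_t τ`, along `u`. -/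
def etaT (V : PointField) (u : ℝ → ℝ → ℝ) : ℝ → ℝ → ℝ := fun t x =>
  partialT (etaAlong V u) t x - partialX u t x * partialT (xiAlong V u) t x
    - partialT u t x * partialT (tauAlong V u) t x

/-- `η^x = D_x η - u_x D_x ξ - u_t D_x τ`, along `u`. -/
def etaX (V : PointField) (u : ℝ → ℝ → ℝ) : ℝ → ℝ → ℝ := fun t x =>
  partialX (etaAlong V u) t x - partialX u t x * partialX (xiAlong V u) t x
    - partialT u t x * partialX (tauAlong V u) t x

/-- `η^{xx} = D_x η^x - u_{xx} D_x ξ - u_{xt} D_x τ`, along `u`. -/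
def etaXX (V : PointField) (u : ℝ → ℝ → ℝ) : ℝ → ℝ → ℝ := fun t x =>
  partialX (etaX V u) t x - partialX (partialX u) t x * partialX (xiAlong V u) t x
    - partialX (partialT u) t x * partialX (tauAlong V u) t x

/-- Coefficient of the prolonged field belonging to `∂^β u / ∂t^β`. -/
def fracEtaT (β : ℝ) (V : PointField) (u : ℝ → ℝ → ℝ) : ℝ → ℝ → ℝ := fun t x =>
  t ^ (1 - β) * etaT V u t x + (1 - β) * tauAlong V u t x * t ^ (-β) * partialT u t x

/-- Coefficient of the prolonged field belonging to `∂^α u / ∂x^α`. -/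
def fracEtaX (α : ℝ) (V : PointField) (u : ℝ → ℝ → ℝ) : ℝ → ℝ → ℝ := fun t x =>
  x ^ (1 - α) * etaX V u t x + (1 - α) * xiAlong V u t x * x ^ (-α) * partialX u t x

/-- Coefficient of the prolonged field belonging to `∂^{2α} u / ∂x^{2α}`. -/
def fracEtaXX (α : ℝ) (V : PointField) (u : ℝ → ℝ → ℝ) : ℝ → ℝ → ℝ := fun t x =>
  x ^ (2 - 2 * α) * etaXX V u t x + (1 - α) * x ^ (1 - 2 * α) * etaX V u t x
    + (2 - 2 * α) * x ^ (1 - 2 * α) * xiAlong V u t x * partialX (partialX u) t x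
    + (1 - α) * (1 - 2 * α) * x ^ (-(2 * α)) * xiAlong V u t x * partialX u t x

/-- The values `(t, x, u, ∂_t^β u, ∂_x^α u, ∂_x^{2α} u)` of `u` at `(t,x)`, where
`∂_x^{2α} = ∂_x^α ∂_x^α`. -/
def fracJet (α β : ℝ) (u : ℝ → ℝ → ℝ) (t x : ℝ) : Fin 6 → ℝ :=
  ![t, x, u t x, fracPartialT β u t x, fracPartialX α u t x,
    fracPartialX α (fracPartialX α u) t x]

/-- The `(2α, β)`-prolongation of `V`, as a tangent vector at `fracJet α β u t x`. -/
def fracProlongation (α β : ℝ) (V : PointField) (u : ℝ → ℝ → ℝ) (t x : ℝ) : Fin 6 → ℝ :=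
  ![tauAlong V u t x, xiAlong V u t x, etaAlong V u t x, fracEtaT β V u t x, fracEtaX α V u t x,
    fracEtaXX α V u t x]

/-- `V` is an infinitesimal Lie point symmetry on `Ω` of the conformable equation
`Δ(t, x, u, ∂_t^β u, ∂_x^α u, ∂_x^{2α} u) = 0`: it is smooth on `Ω` and satisfies the Lie symmetry
condition `pr^{(2α,β)} V (Δ) = 0` whenever `Δ = 0`. All values of the derivatives of `u` are
reached by letting `u` run through all smooth functions with graph in `Ω`; `Δ = 0` is only required
at the point under consideration. -/
def IsLieSymmetry (Δ : (Fin 6 → ℝ) → ℝ) (α β : ℝ) (Ω : Set (ℝ × ℝ × ℝ)) (V : PointField) : Prop :=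
  ContDiffOn ℝ ∞ V Ω ∧
  ∀ (U : Set (ℝ × ℝ)) (u : ℝ → ℝ → ℝ), IsOpen U →
    ContDiffOn ℝ ∞ (fun p : ℝ × ℝ => u p.1 p.2) U →
    (∀ t x : ℝ, (t, x) ∈ U → (t, x, u t x) ∈ Ω) →
    ∀ t x : ℝ, (t, x) ∈ U → Δ (fracJet α β u t x) = 0 →
      fderiv ℝ Δ (fracJet α β u t x) (fracProlongation α β V u t x) = 0

/-- The classical counterpart of `IsLieSymmetry`, for an equation
`Δ(t, x, u, u_t, u_x, u_{xx}) = 0` with ordinary partial derivatives and the ordinary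
prolongation of `V`. -/
def IsClassicalLieSymmetry (Δ : (Fin 6 → ℝ) → ℝ) (Ω : Set (ℝ × ℝ × ℝ)) (V : PointField) : Prop :=
  ContDiffOn ℝ ∞ V Ω ∧
  ∀ (U : Set (ℝ × ℝ)) (u : ℝ → ℝ → ℝ), IsOpen U →
    ContDiffOn ℝ ∞ (fun p : ℝ × ℝ => u p.1 p.2) U →
    (∀ t x : ℝ, (t, x) ∈ U → (t, x, u t x) ∈ Ω) →
    ∀ t x : ℝ, (t, x) ∈ U →
      Δ ![t, x, u t x, partialT u t x, partialX u t x, partialX (partialX u) t x] = 0 →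
      fderiv ℝ Δ ![t, x, u t x, partialT u t x, partialX u t x, partialX (partialX u) t x]
        ![tauAlong V u t x, xiAlong V u t x, etaAlong V u t x, etaT V u t x, etaX V u t x,
          etaXX V u t x] = 0

/-- The Burgers expression `p + a u q + b r` in the variables `(t, x, u, p, q, r)`, so that
`burgers a b (fracJet α β u t x) = 0` is `∂_t^β u + a u ∂_x^α u + b ∂_x^{2α} u = 0`. -/
def burgers (a b : ℝ) (j : Fin 6 → ℝ) : ℝ := j 3 + a * j 2 * j 4 + b * j 5

/-- `V₁ = t^{1-β} ∂_t`. -/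
def burgersV1 (β : ℝ) : PointField := fun p => (p.1 ^ (1 - β), 0, 0)

/-- `V₂ = x^{1-α} ∂_x`. -/
def burgersV2 (α : ℝ) : PointField := fun p => (0, p.2.1 ^ (1 - α), 0)

/-- `V₃ = (a t^β x^{1-α} / β) ∂_x + ∂_u`. -/
def burgersV3 (a α β : ℝ) : PointField := fun p =>
  (0, a * p.1 ^ β * p.2.1 ^ (1 - α) / β, 1)

/-- `V₄ = -(2t/β) ∂_t - (x/α) ∂_x + u ∂_u`. -/
def burgersV4 (α β : ℝ) : PointField := fun p => (-2 * p.1 / β, -p.2.1 / α, p.2.2)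

/-- `V₅ = (t^{1+β}/β²) ∂_t + (x t^β/(αβ)) ∂_x + (-t^β u/β + x^α/(aα)) ∂_u`. -/
def burgersV5 (a α β : ℝ) : PointField := fun p =>
  (p.1 ^ (1 + β) / β ^ 2, p.2.1 * p.1 ^ β / (α * β),
    -(p.1 ^ β * p.2.2) / β + p.2.1 ^ α / (a * α))

/-- The five fields `V₁, …, V₅`. -/
def burgersFields (a α β : ℝ) : Fin 5 → PointField :=
  ![burgersV1 β, burgersV2 α, burgersV3 a α β, burgersV4 α β, burgersV5 a α β]

/-- The five classical Burgers fields `∂_t`, `∂_x`, `a t ∂_x + ∂_u`, `-2t ∂_t - x ∂_x + u ∂_u`,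
`t² ∂_t + x t ∂_x + (-t u + x/a) ∂_u`. -/
def classicalBurgersFields (a : ℝ) : Fin 5 → PointField :=
  ![fun _ => (1, 0, 0),
    fun _ => (0, 1, 0),
    fun p => (0, a * p.1, 1),
    fun p => (-2 * p.1, -p.2.1, p.2.2),
    fun p => (p.1 ^ 2, p.2.1 * p.1, -(p.1 * p.2.2) + p.2.1 / a)]

end

noncomputable section

/-! On smooth functions the conformable derivatives are `t^(1-β) ∂_t` and `x^(1-α) ∂_x`, which are
the coordinate derivatives for `T = t^β/β` and `X = x^α/α`. In the variables `(T, X, u)` the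
equation is the classical Burgers equation, and the claim is its classical symmetry computation.
Instead of changing variables, the proof expands everything in the commuting frame `V₁`, `V₂`,
`∂_u`. The correction terms in the fractional prolongation are exactly those that turn it into the
ordinary prolongation of the frame coefficients `τ`, `ξ`, `η` (`fracEtaT_eq`, `fracEtaX_eq`,
`fracEtaXX_eq`).

Functions quadratic in `T` and `X` realise every jet `(P, Q, R, S)`, so Lie's criterion is a
polynomial identity in the jet variables on `P + a u Q + b R = 0` (`isLieSymmetry_burgers_iff`). Its
coefficients are the determining equations. They force `τ` to depend on `T` alone, and `τ_TTT = 0`,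
`ξ_X = τ_T / 2`, `ξ_TT = 0`, with `η` determined by `τ` and `ξ`. Integration on the connected set
`Ω` leaves five constants (`DeterminingEquations.exists_eq_quadPoly`), and conversely these
polynomials solve the equations. The bracket of two general solutions, computed once in
`lieBracket_burgersField`, gives closure and all commutators. -/

/-- The derivative of the function `f` along the field `V`. -/
def fieldDeriv (V : PointField) (f : ℝ × ℝ × ℝ → ℝ) : ℝ × ℝ × ℝ → ℝ := fun p => fderiv ℝ f p (V p)

/-- The field `∂_u`. -/
def verticalField : PointField := fun _ => (0, 0, 1)

/-- The region `t > 0`, `x > 0`. -/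
def positiveRegion : Set (ℝ × ℝ × ℝ) := {p | 0 < p.1 ∧ 0 < p.2.1}

/-! ### The frame `V₁`, `V₂`, `∂_u` and derivatives along it. -/

lemma contDiffOn_burgersV1 (β : ℝ) : ContDiffOn ℝ ∞ (burgersV1 β) positiveRegion := by
  unfold burgersV1
  refine ContDiffOn.prodMk ?_ contDiffOn_const
  exact contDiff_fst.contDiffOn.rpow_const_of_ne fun p hp => hp.1.ne'

lemma contDiffOn_burgersV2 (α : ℝ) : ContDiffOn ℝ ∞ (burgersV2 α) positiveRegion := by
  unfold burgersV2
  refine ContDiffOn.prodMk contDiffOn_const (ContDiffOn.prodMk ?_ contDiffOn_const)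
  exact contDiff_snd.fst.contDiffOn.rpow_const_of_ne fun p hp => hp.2.ne'

lemma contDiffOn_verticalField (s : Set (ℝ × ℝ × ℝ)) : ContDiffOn ℝ ∞ verticalField s :=
  contDiffOn_const

/-- Where `t, x > 0` both weights are nonzero, so the three fields span the tangent space. Every
differential is thus known from its values on the frame. -/
lemma apply_eq_of_mem_positiveRegion (α β : ℝ) (L : ℝ × ℝ × ℝ →L[ℝ] ℝ) {p : ℝ × ℝ × ℝ}
    (hp : p ∈ positiveRegion) (v : ℝ × ℝ × ℝ) :
    L v = v.1 / p.1 ^ (1 - β) * L (burgersV1 β p) + v.2.1 / p.2.1 ^ (1 - α) * L (burgersV2 α p)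
      + v.2.2 * L (verticalField p) := by
  have h1 := (Real.rpow_pos_of_pos hp.1 (1 - β)).ne'
  have h2 := (Real.rpow_pos_of_pos hp.2 (1 - α)).ne'
  simp only [← smul_eq_mul, ← map_smul, ← map_add]
  congr 1
  ext <;> simp [burgersV1, burgersV2, verticalField, h1, h2]

section FieldDeriv

variable {Ω : Set (ℝ × ℝ × ℝ)} {V W : PointField} {f g : ℝ × ℝ × ℝ → ℝ}

lemma ContDiffOn.fieldDeriv (hΩ : IsOpen Ω) (hf : ContDiffOn ℝ ∞ f Ω) (hV : ContDiffOn ℝ ∞ V Ω) :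
    ContDiffOn ℝ ∞ (fieldDeriv V f) Ω :=
  (hf.fderiv_of_isOpen hΩ (by simp)).clm_apply hV

lemma ContDiffOn.differentiableAt_of_isOpen {E F : Type*} [NormedAddCommGroup E] [NormedSpace ℝ E]
    [NormedAddCommGroup F] [NormedSpace ℝ F] {f : E → F} {s : Set E} {x : E}
    (hf : ContDiffOn ℝ ∞ f s) (hs : IsOpen s) (hx : x ∈ s) : DifferentiableAt ℝ f x :=
  (hf.contDiffAt (hs.mem_nhds hx)).differentiableAt (by simp)

lemma fieldDeriv_congr (hΩ : IsOpen Ω) (h : Set.EqOn f g Ω) :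
    Set.EqOn (fieldDeriv V f) (fieldDeriv V g) Ω := fun p hp => by
  rw [fieldDeriv, fieldDeriv, (h.eventuallyEq_of_mem (hΩ.mem_nhds hp)).fderiv_eq]

lemma fieldDeriv_eq_zero (hΩ : IsOpen Ω) (h : ∀ p ∈ Ω, f p = 0) :
    ∀ p ∈ Ω, fieldDeriv V f p = 0 := fun p hp => by
  rw [fieldDeriv_congr hΩ (g := fun _ => 0) h hp]
  simp [fieldDeriv]

/-- By the symmetry of the second derivative, `V(Wf) - W(Vf)` involves only first derivatives of
`f`, namely `[V, W] f`. -/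
lemma fieldDeriv_comm (hΩ : IsOpen Ω) (hf : ContDiffOn ℝ ∞ f Ω) (hV : ContDiffOn ℝ ∞ V Ω)
    (hW : ContDiffOn ℝ ∞ W Ω) (hVW : ∀ p ∈ Ω, VectorField.lieBracket ℝ V W p = 0) :
    ∀ p ∈ Ω, fieldDeriv V (fieldDeriv W f) p = fieldDeriv W (fieldDeriv V f) p := fun p hp => by
  have hf' : DifferentiableAt ℝ (fderiv ℝ f) p :=
    (hf.fderiv_of_isOpen hΩ (m := ∞) (by simp)).differentiableAt_of_isOpen hΩ hp
  have key : ∀ Z : PointField, DifferentiableAt ℝ Z p → ∀ v, fderiv ℝ (fieldDeriv Z f) p v =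
      fderiv ℝ f p (fderiv ℝ Z p v) + fderiv ℝ (fderiv ℝ f) p v (Z p) := fun Z hZ v => by
    have := (hf'.hasFDerivAt.clm_apply hZ.hasFDerivAt).fderiv
    unfold fieldDeriv
    rw [this]
    simp
  have hs : IsSymmSndFDerivAt ℝ f p :=
    (hf.contDiffAt (hΩ.mem_nhds hp)).isSymmSndFDerivAt
      (by
        simp only [minSmoothness_of_isRCLikeNormedField]
        exact WithTop.coe_le_coe.2 (le_top : (2 : ℕ∞) ≤ ⊤))
  have hb := hVW p hp
  rw [VectorField.lieBracket, sub_eq_zero] at hb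
  rw [fieldDeriv, key W (hW.differentiableAt_of_isOpen hΩ hp), fieldDeriv,
    key V (hV.differentiableAt_of_isOpen hΩ hp), hb, hs.eq]

end FieldDeriv

/-! ### Polynomials in `T`, `X` and `u`. -/

lemma hasFDerivAt_rpow_fst (r : ℝ) {p : ℝ × ℝ × ℝ} (hp : p ∈ positiveRegion) :
    HasFDerivAt (fun q : ℝ × ℝ × ℝ => q.1 ^ r)
      ((r * p.1 ^ (r - 1)) • ContinuousLinearMap.fst ℝ ℝ (ℝ × ℝ)) p :=
  HasFDerivAt.rpow_const hasFDerivAt_fst (Or.inl hp.1.ne')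

lemma hasFDerivAt_rpow_snd (r : ℝ) {p : ℝ × ℝ × ℝ} (hp : p ∈ positiveRegion) :
    HasFDerivAt (fun q : ℝ × ℝ × ℝ => q.2.1 ^ r)
      ((r * p.2.1 ^ (r - 1)) •
        (ContinuousLinearMap.fst ℝ ℝ ℝ).comp (ContinuousLinearMap.snd ℝ ℝ (ℝ × ℝ))) p :=
  HasFDerivAt.rpow_const (hasFDerivAt_snd (𝕜 := ℝ) (E := ℝ) (F := ℝ × ℝ)).fst (Or.inl hp.2.ne')

/-- Polynomials in `t^β/β`, `x^α/α` and `u` of degree two, without the terms in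
`(x^α/α)²`, `(x^α/α) u` and `u²`. -/
def quadPoly (α β k₀ k₁ k₂ k₃ k₄ k₅ k₆ : ℝ) : ℝ × ℝ × ℝ → ℝ := fun p =>
  k₀ + k₁ * (p.1 ^ β / β) + k₂ * (p.2.1 ^ α / α) + k₃ * p.2.2 + k₄ * (p.1 ^ β / β) ^ 2
    + k₅ * ((p.2.1 ^ α / α) * (p.1 ^ β / β)) + k₆ * ((p.1 ^ β / β) * p.2.2)

section QuadPoly

variable {α β : ℝ} (k₀ k₁ k₂ k₃ k₄ k₅ k₆ : ℝ) {p : ℝ × ℝ × ℝ}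

lemma hasFDerivAt_quadPoly (hp : p ∈ positiveRegion) :
    ∃ L : ℝ × ℝ × ℝ →L[ℝ] ℝ, HasFDerivAt (quadPoly α β k₀ k₁ k₂ k₃ k₄ k₅ k₆) L p ∧
      ∀ v, L v = (k₁ + 2 * k₄ * (p.1 ^ β / β) + k₅ * (p.2.1 ^ α / α) + k₆ * p.2.2) *
          (β * p.1 ^ (β - 1) / β * v.1) +
        (k₂ + k₅ * (p.1 ^ β / β)) * (α * p.2.1 ^ (α - 1) / α * v.2.1) +
        (k₃ + k₆ * (p.1 ^ β / β)) * v.2.2 := by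
  have hT := (hasFDerivAt_rpow_fst β hp).mul_const β⁻¹
  have hX := (hasFDerivAt_rpow_snd α hp).mul_const α⁻¹
  have hu := (hasFDerivAt_snd (𝕜 := ℝ) (E := ℝ) (F := ℝ × ℝ) (p := p)).snd
  simp only [← div_eq_mul_inv] at hT hX
  refine ⟨_, ((((((hT.const_mul k₁).const_add k₀).add (hX.const_mul k₂)).add
    (hu.const_mul k₃)).add ((hT.pow 2).const_mul k₄)).add ((hX.mul hT).const_mul k₅)).add
    ((hT.mul hu).const_mul k₆), fun v => ?_⟩
  simp
  ring

lemma contDiffOn_quadPoly :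
    ContDiffOn ℝ ∞ (quadPoly α β k₀ k₁ k₂ k₃ k₄ k₅ k₆) positiveRegion := by
  have hT : ContDiffOn ℝ ∞ (fun q : ℝ × ℝ × ℝ => q.1 ^ β / β) positiveRegion :=
    (contDiff_fst.contDiffOn.rpow_const_of_ne fun p hp => hp.1.ne').div_const _
  have hX : ContDiffOn ℝ ∞ (fun q : ℝ × ℝ × ℝ => q.2.1 ^ α / α) positiveRegion :=
    (contDiff_snd.fst.contDiffOn.rpow_const_of_ne fun p hp => hp.2.ne').div_const _
  have hu : ContDiffOn ℝ ∞ (fun q : ℝ × ℝ × ℝ => q.2.2) positiveRegion :=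
    contDiff_snd.snd.contDiffOn
  exact ((((((contDiffOn_const.add (contDiffOn_const.mul hT)).add (contDiffOn_const.mul hX)).add
    (contDiffOn_const.mul hu)).add (contDiffOn_const.mul (hT.pow 2))).add
    (contDiffOn_const.mul (hX.mul hT))).add (contDiffOn_const.mul (hT.mul hu)))

/-- Along `V₁` one differentiates in `T`, because the weight `t^(1-β)` cancels `t^(β-1)`. The family
is closed under the three frame derivatives, so that differentiation becomes a shift of the list of
coefficients. -/
lemma fieldDeriv_burgersV1_quadPoly (hβ : β ≠ 0) (hp : p ∈ positiveRegion) :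
    fieldDeriv (burgersV1 β) (quadPoly α β k₀ k₁ k₂ k₃ k₄ k₅ k₆) p =
      quadPoly α β k₁ (2 * k₄) k₅ k₆ 0 0 0 p := by
  obtain ⟨L, hL, h⟩ := hasFDerivAt_quadPoly (α := α) (β := β) k₀ k₁ k₂ k₃ k₄ k₅ k₆ hp
  have : p.1 ^ (β - 1) * p.1 ^ (1 - β) = 1 := by
    rw [← Real.rpow_add hp.1]; simp
  rw [fieldDeriv, hL.fderiv, h, burgersV1, mul_div_cancel_left₀ _ hβ, this]
  simp [quadPoly]

lemma fieldDeriv_burgersV2_quadPoly (hα : α ≠ 0) (hp : p ∈ positiveRegion) :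
    fieldDeriv (burgersV2 α) (quadPoly α β k₀ k₁ k₂ k₃ k₄ k₅ k₆) p =
      quadPoly α β k₂ k₅ 0 0 0 0 0 p := by
  obtain ⟨L, hL, h⟩ := hasFDerivAt_quadPoly (α := α) (β := β) k₀ k₁ k₂ k₃ k₄ k₅ k₆ hp
  have : p.2.1 ^ (α - 1) * p.2.1 ^ (1 - α) = 1 := by
    rw [← Real.rpow_add hp.2]; simp
  rw [fieldDeriv, hL.fderiv, h, burgersV2, mul_div_cancel_left₀ _ hα, this]
  simp [quadPoly]

lemma fieldDeriv_verticalField_quadPoly (hp : p ∈ positiveRegion) :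
    fieldDeriv verticalField (quadPoly α β k₀ k₁ k₂ k₃ k₄ k₅ k₆) p =
      quadPoly α β k₃ k₆ 0 0 0 0 0 p := by
  obtain ⟨L, hL, h⟩ := hasFDerivAt_quadPoly (α := α) (β := β) k₀ k₁ k₂ k₃ k₄ k₅ k₆ hp
  rw [fieldDeriv, hL.fderiv, h]
  simp [quadPoly, verticalField]

/-- On a connected open set a function is determined up to a constant by its derivatives along
`V₁`, `V₂` and `∂_u`. -/
lemma exists_eq_quadPoly {Ω : Set (ℝ × ℝ × ℝ)} (hΩ : IsOpen Ω) (hΩc : IsPreconnected Ω)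
    (hpos : Ω ⊆ positiveRegion) (hα : α ≠ 0) (hβ : β ≠ 0) {f : ℝ × ℝ × ℝ → ℝ}
    (hf : ContDiffOn ℝ ∞ f Ω)
    (h1 : ∀ p ∈ Ω, fieldDeriv (burgersV1 β) f p = quadPoly α β k₁ (2 * k₄) k₅ k₆ 0 0 0 p)
    (h2 : ∀ p ∈ Ω, fieldDeriv (burgersV2 α) f p = quadPoly α β k₂ k₅ 0 0 0 0 0 p)
    (h3 : ∀ p ∈ Ω, fieldDeriv verticalField f p = quadPoly α β k₃ k₆ 0 0 0 0 0 p) :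
    ∃ k₀, ∀ p ∈ Ω, f p = quadPoly α β k₀ k₁ k₂ k₃ k₄ k₅ k₆ p := by
  -- The candidate with zero constant term; `f - g` has vanishing frame derivatives, hence vanishing
  -- differential, and its constant value is `k₀`.
  set g := quadPoly α β 0 k₁ k₂ k₃ k₄ k₅ k₆ with hg
  have hgs : ContDiffOn ℝ ∞ g Ω := (contDiffOn_quadPoly _ _ _ _ _ _ _).mono hpos
  have hfd := fun p (hp : p ∈ Ω) => hf.differentiableAt_of_isOpen hΩ hp
  have hgd := fun p (hp : p ∈ Ω) => hgs.differentiableAt_of_isOpen hΩ hp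
  obtain ⟨k, hk⟩ := hΩ.exists_is_const_of_fderiv_eq_zero (𝕜 := ℝ) (f := f - g) hΩc
    (fun p hp => ((hfd p hp).sub (hgd p hp)).differentiableWithinAt) (fun p hp => by
      have hp' := hpos hp
      rw [fderiv_sub (hfd p hp) (hgd p hp)]
      have e1 := h1 p hp
      have e2 := h2 p hp
      have e3 := h3 p hp
      rw [← fieldDeriv_burgersV1_quadPoly 0 k₁ k₂ k₃ k₄ k₅ k₆ hβ hp', ← hg, fieldDeriv, fieldDeriv,
        ← sub_eq_zero, ← sub_apply] at e1
      rw [← fieldDeriv_burgersV2_quadPoly 0 k₁ k₂ k₃ k₄ k₅ k₆ hα hp', ← hg, fieldDeriv, fieldDeriv,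
        ← sub_eq_zero, ← sub_apply] at e2
      rw [← fieldDeriv_verticalField_quadPoly 0 k₁ k₂ k₃ k₄ k₅ k₆ hp', ← hg, fieldDeriv, fieldDeriv,
        ← sub_eq_zero, ← sub_apply] at e3
      refine ContinuousLinearMap.ext fun v => ?_
      rw [apply_eq_of_mem_positiveRegion α β _ hp', e1, e2, e3]
      simp)
  refine ⟨k, fun p hp => ?_⟩
  have := hk p hp
  simp only [Pi.sub_apply, hg, quadPoly] at this
  simp only [quadPoly]
  linarith

end QuadPoly

/-! ### The general symmetry field and its brackets. -/

/-- The general field of the symmetry algebra. -/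
def burgersField (a α β c₁ c₂ c₃ c₄ c₅ : ℝ) : PointField := fun p =>
  (c₁ * p.1 ^ (1 + β) / β ^ 2 - 2 * c₂ * p.1 / β + c₄ * p.1 ^ (1 - β),
   c₁ * p.2.1 * p.1 ^ β / (α * β) - c₂ * p.2.1 / α + a * c₃ / β * p.1 ^ β * p.2.1 ^ (1 - α)
     + c₅ * p.2.1 ^ (1 - α),
   (-c₁ * p.1 ^ β / β + c₂) * p.2.2 + (c₁ * p.2.1 ^ α / (a * α) + c₃))

lemma contDiffOn_burgersField (a α β c₁ c₂ c₃ c₄ c₅ : ℝ) :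
    ContDiffOn ℝ ∞ (burgersField a α β c₁ c₂ c₃ c₄ c₅) positiveRegion := by
  have ht : ∀ r : ℝ, ContDiffOn ℝ ∞ (fun q : ℝ × ℝ × ℝ => q.1 ^ r) positiveRegion := fun r =>
    contDiff_fst.contDiffOn.rpow_const_of_ne fun p hp => hp.1.ne'
  have hx : ∀ r : ℝ, ContDiffOn ℝ ∞ (fun q : ℝ × ℝ × ℝ => q.2.1 ^ r) positiveRegion := fun r =>
    contDiff_snd.fst.contDiffOn.rpow_const_of_ne fun p hp => hp.2.ne'
  have := ht (1 + β)
  have := ht (1 - β)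
  have := ht β
  have := hx (1 - α)
  have := hx α
  unfold burgersField
  fun_prop

lemma fderiv_burgersField (a α β c₁ c₂ c₃ c₄ c₅ : ℝ) {p : ℝ × ℝ × ℝ} (hp : p ∈ positiveRegion)
    (v : ℝ × ℝ × ℝ) :
    fderiv ℝ (burgersField a α β c₁ c₂ c₃ c₄ c₅) p v =
      (c₁ * ((1 + β) * p.1 ^ β * v.1) / β ^ 2 - 2 * c₂ * v.1 / β
          + c₄ * ((1 - β) * p.1 ^ (-β) * v.1),
       c₁ * (v.2.1 * p.1 ^ β + p.2.1 * (β * p.1 ^ (β - 1) * v.1)) / (α * β) - c₂ * v.2.1 / α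
         + a * c₃ / β * (β * p.1 ^ (β - 1) * v.1 * p.2.1 ^ (1 - α)
           + p.1 ^ β * ((1 - α) * p.2.1 ^ (-α) * v.2.1))
         + c₅ * ((1 - α) * p.2.1 ^ (-α) * v.2.1),
       (-c₁ * p.1 ^ β / β + c₂) * v.2.2 - c₁ * (β * p.1 ^ (β - 1) * v.1) / β * p.2.2
         + c₁ * (α * p.2.1 ^ (α - 1) * v.2.1) / (a * α)) := by
  have ht := hasFDerivAt_fst (𝕜 := ℝ) (E := ℝ) (F := ℝ × ℝ) (p := p)
  have hx := (hasFDerivAt_snd (𝕜 := ℝ) (E := ℝ) (F := ℝ × ℝ) (p := p)).fst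
  have hu := (hasFDerivAt_snd (𝕜 := ℝ) (E := ℝ) (F := ℝ × ℝ) (p := p)).snd
  have h1 := hasFDerivAt_rpow_fst (1 + β) hp
  have h2 := hasFDerivAt_rpow_fst (1 - β) hp
  have h3 := hasFDerivAt_rpow_fst β hp
  have h4 := hasFDerivAt_rpow_snd (1 - α) hp
  have h5 := hasFDerivAt_rpow_snd α hp
  have H := ((((h1.const_mul c₁).mul_const (β ^ 2)⁻¹).sub
      ((ht.const_mul (2 * c₂)).mul_const β⁻¹)).add (h2.const_mul c₄)).prodMk
    ((((((hx.const_mul c₁).mul h3).mul_const (α * β)⁻¹).sub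
      ((hx.const_mul c₂).mul_const α⁻¹)).add ((h3.const_mul (a * c₃ / β)).mul h4)).add
        (h4.const_mul c₅) |>.prodMk
    (((((h3.const_mul (-c₁)).mul_const β⁻¹).add_const c₂).mul hu).add
      (((h5.const_mul c₁).mul_const (a * α)⁻¹).add_const c₃)))
  simp only [← div_eq_mul_inv] at H
  have := congrArg (fun L => L v) H.fderiv
  unfold burgersField
  refine this.trans ?_
  have e1 : (1 + β - 1 : ℝ) = β := by ring
  have e2 : (1 - β - 1 : ℝ) = -β := by ring
  have e3 : (1 - α - 1 : ℝ) = -α := by ring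
  rw [e1, e2, e3]
  refine Prod.ext ?_ (Prod.ext ?_ ?_) <;> simp <;> ring

/-- The constants `c₁, …, c₅` are the coordinates along `V₅, V₄, V₃, V₁, V₂`, in this order. The
right-hand side therefore carries the whole table of structure constants. -/
lemma lieBracket_burgersField {a α β : ℝ} (ha : a ≠ 0) (hα : α ≠ 0) (hβ : β ≠ 0)
    (c₁ c₂ c₃ c₄ c₅ d₁ d₂ d₃ d₄ d₅ : ℝ) {p : ℝ × ℝ × ℝ} (hp : p ∈ positiveRegion) :
    VectorField.lieBracket ℝ (burgersField a α β c₁ c₂ c₃ c₄ c₅)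
        (burgersField a α β d₁ d₂ d₃ d₄ d₅) p =
      burgersField a α β (-2 * (c₂ * d₁ - c₁ * d₂)) (-(c₄ * d₁ - c₁ * d₄))
        ((c₅ * d₁ - c₁ * d₅) / a + (c₃ * d₂ - c₂ * d₃)) (-2 * (c₄ * d₂ - c₂ * d₄))
        (a * (c₄ * d₃ - c₃ * d₄) - (c₅ * d₂ - c₂ * d₅)) p := by
  rw [VectorField.lieBracket, fderiv_burgersField _ _ _ _ _ _ _ _ hp,
    fderiv_burgersField _ _ _ _ _ _ _ _ hp]
  obtain ⟨t, x, u⟩ := p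
  obtain ⟨ht, hx⟩ : 0 < t ∧ 0 < x := hp
  have e1 : t ^ (1 + β) = t * t ^ β := by rw [Real.rpow_add ht, Real.rpow_one]
  have e2 : t ^ (1 - β) = t / t ^ β := by rw [Real.rpow_sub ht, Real.rpow_one]
  have e3 : t ^ (β - 1) = t ^ β / t := by rw [Real.rpow_sub ht, Real.rpow_one]
  have e4 : t ^ (-β) = (t ^ β)⁻¹ := Real.rpow_neg ht.le _
  have e5 : x ^ (1 - α) = x / x ^ α := by rw [Real.rpow_sub hx, Real.rpow_one]
  have e6 : x ^ (α - 1) = x ^ α / x := by rw [Real.rpow_sub hx, Real.rpow_one]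
  have e7 : x ^ (-α) = (x ^ α)⁻¹ := Real.rpow_neg hx.le _
  have hk := (Real.rpow_pos_of_pos ht β).ne'
  have hl := (Real.rpow_pos_of_pos hx α).ne'
  have ht' := ht.ne'
  have hx' := hx.ne'
  simp only [burgersField, e1, e2, e3, e4, e5, e6, e7]
  -- All powers are now expressed by `t`, `x`, `t^β` and `x^α`, and what remains is an identity of
  -- rational functions in independent variables.
  generalize t ^ β = k at *
  generalize x ^ α = l at *
  refine Prod.ext ?_ (Prod.ext ?_ ?_)
  all_goals
    simp only [Prod.fst_sub, Prod.snd_sub]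
    field_simp
    ring

section Basis

variable (a α β : ℝ)

lemma burgersV1_eq : burgersV1 β = burgersField a α β 0 0 0 1 0 := by
  ext p <;> simp [burgersV1, burgersField]

lemma burgersV2_eq : burgersV2 α = burgersField a α β 0 0 0 0 1 := by
  ext p <;> simp [burgersV2, burgersField]

lemma burgersV3_eq : burgersV3 a α β = burgersField a α β 0 0 1 0 0 := by
  ext p
  · simp [burgersV3, burgersField]
  · simp [burgersV3, burgersField]
    ring
  · simp [burgersV3, burgersField]

lemma burgersV4_eq : burgersV4 α β = burgersField a α β 0 1 0 0 0 := by
  ext p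
  all_goals
    simp only [burgersV4, burgersField]
    ring

lemma burgersV5_eq : burgersV5 a α β = burgersField a α β 1 0 0 0 0 := by
  ext p
  all_goals
    simp only [burgersV5, burgersField]
    ring

end Basis

/-! ### Conformable derivatives as weighted partial derivatives. -/

lemma conformableDeriv_of_hasDerivAt (α : ℝ) {f : ℝ → ℝ} {f' x : ℝ} (hf : HasDerivAt f f' x) :
    conformableDeriv α f x = x ^ (1 - α) * f' := by
  have h : HasDerivAt (fun ε : ℝ => x + ε * x ^ (1 - α)) (x ^ (1 - α)) 0 := by
    simpa using ((hasDerivAt_id (0 : ℝ)).mul_const (x ^ (1 - α))).const_add x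
  have h' := HasDerivAt.scomp (g₁ := f) (g₁' := f') (0 : ℝ) (by simpa using hf) h
  exact h'.deriv.trans (smul_eq_mul _ _)

section Partial

variable {U : Set (ℝ × ℝ)} {g : ℝ → ℝ → ℝ} {t x : ℝ}

lemma hasDerivAt_partialT (hU : IsOpen U) (hg : ContDiffOn ℝ ∞ (fun p : ℝ × ℝ => g p.1 p.2) U)
    (h : (t, x) ∈ U) : HasDerivAt (fun s => g s x) (partialT g t x) t := by
  have hd := hg.differentiableAt_of_isOpen hU h
  have : DifferentiableAt ℝ (fun s => g s x) t :=
    DifferentiableAt.comp (g := fun p : ℝ × ℝ => g p.1 p.2) (f := fun s => (s, x)) t hd (by fun_prop)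
  exact this.hasDerivAt

lemma hasDerivAt_partialX (hU : IsOpen U) (hg : ContDiffOn ℝ ∞ (fun p : ℝ × ℝ => g p.1 p.2) U)
    (h : (t, x) ∈ U) : HasDerivAt (fun y => g t y) (partialX g t x) x := by
  have hd := hg.differentiableAt_of_isOpen hU h
  have : DifferentiableAt ℝ (fun y => g t y) x :=
    DifferentiableAt.comp (g := fun p : ℝ × ℝ => g p.1 p.2) (f := fun y => (t, y)) x hd (by fun_prop)
  exact this.hasDerivAt

lemma contDiffOn_partialT (hU : IsOpen U) (hg : ContDiffOn ℝ ∞ (fun p : ℝ × ℝ => g p.1 p.2) U) :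
    ContDiffOn ℝ ∞ (fun p : ℝ × ℝ => partialT g p.1 p.2) U := by
  refine ((hg.fderiv_of_isOpen hU (m := ∞) (by simp)).clm_apply
    (contDiffOn_const (c := ((1, 0) : ℝ × ℝ)))).congr fun p hp => ?_
  have hd := (hg.differentiableAt_of_isOpen hU hp).hasFDerivAt
  have hc : HasDerivAt (fun s : ℝ => (s, p.2)) (1, 0) p.1 :=
    (hasDerivAt_id p.1).prodMk (hasDerivAt_const _ _)
  exact (HasFDerivAt.comp_hasDerivAt (f := fun s : ℝ => (s, p.2)) p.1 hd hc).deriv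

lemma contDiffOn_partialX (hU : IsOpen U) (hg : ContDiffOn ℝ ∞ (fun p : ℝ × ℝ => g p.1 p.2) U) :
    ContDiffOn ℝ ∞ (fun p : ℝ × ℝ => partialX g p.1 p.2) U := by
  refine ((hg.fderiv_of_isOpen hU (m := ∞) (by simp)).clm_apply
    (contDiffOn_const (c := ((0, 1) : ℝ × ℝ)))).congr fun p hp => ?_
  have hd := (hg.differentiableAt_of_isOpen hU hp).hasFDerivAt
  have hc : HasDerivAt (fun y : ℝ => (p.1, y)) (0, 1) p.2 :=
    (hasDerivAt_const _ _).prodMk (hasDerivAt_id p.2)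
  exact (HasFDerivAt.comp_hasDerivAt (f := fun y : ℝ => (p.1, y)) p.2 hd hc).deriv

lemma fracPartialT_eq (β : ℝ) (hU : IsOpen U)
    (hg : ContDiffOn ℝ ∞ (fun p : ℝ × ℝ => g p.1 p.2) U) (h : (t, x) ∈ U) :
    fracPartialT β g t x = t ^ (1 - β) * partialT g t x :=
  conformableDeriv_of_hasDerivAt β (hasDerivAt_partialT hU hg h)

lemma fracPartialX_eq (α : ℝ) (hU : IsOpen U)
    (hg : ContDiffOn ℝ ∞ (fun p : ℝ × ℝ => g p.1 p.2) U) (h : (t, x) ∈ U) :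
    fracPartialX α g t x = x ^ (1 - α) * partialX g t x :=
  conformableDeriv_of_hasDerivAt α (hasDerivAt_partialX hU hg h)

lemma contDiffOn_fracPartialT (β : ℝ) (hU : IsOpen U) (hpos : ∀ p ∈ U, 0 < p.1)
    (hg : ContDiffOn ℝ ∞ (fun p : ℝ × ℝ => g p.1 p.2) U) :
    ContDiffOn ℝ ∞ (fun p : ℝ × ℝ => fracPartialT β g p.1 p.2) U :=
  ((contDiff_fst.contDiffOn.rpow_const_of_ne fun p hp => (hpos p hp).ne').mul
    (contDiffOn_partialT hU hg)).congr fun _ hp => fracPartialT_eq β hU hg hp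

lemma contDiffOn_fracPartialX (α : ℝ) (hU : IsOpen U) (hpos : ∀ p ∈ U, 0 < p.2)
    (hg : ContDiffOn ℝ ∞ (fun p : ℝ × ℝ => g p.1 p.2) U) :
    ContDiffOn ℝ ∞ (fun p : ℝ × ℝ => fracPartialX α g p.1 p.2) U :=
  ((contDiff_snd.contDiffOn.rpow_const_of_ne fun p hp => (hpos p hp).ne').mul
    (contDiffOn_partialX hU hg)).congr fun _ hp => fracPartialX_eq α hU hg hp

lemma hasDerivAt_fracPartialX (α : ℝ) (hU : IsOpen U) (hx : 0 < x)
    (hg : ContDiffOn ℝ ∞ (fun p : ℝ × ℝ => g p.1 p.2) U) (h : (t, x) ∈ U) :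
    HasDerivAt (fun y => g t y) (fracPartialX α g t x / x ^ (1 - α)) x := by
  rw [fracPartialX_eq α hU hg h, mul_div_cancel_left₀ _ (Real.rpow_pos_of_pos hx _).ne']
  exact hasDerivAt_partialX hU hg h

lemma eventually_mem_of_isOpen (hU : IsOpen U) (h : (t, x) ∈ U) :
    (∀ᶠ s in nhds t, (s, x) ∈ U) ∧ ∀ᶠ y in nhds x, (t, y) ∈ U := by
  constructor
  · exact (Continuous.prodMk_left x).continuousAt.preimage_mem_nhds (hU.mem_nhds h)
  · exact (Continuous.prodMk_right t).continuousAt.preimage_mem_nhds (hU.mem_nhds h)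

end Partial

/-! ### The fractional prolongation in the frame. -/

/-- The coefficient of `t^(1-β) ∂_t` in the field `V`. -/
def tauHat (β : ℝ) (V : PointField) : ℝ × ℝ × ℝ → ℝ := fun p => (V p).1 / p.1 ^ (1 - β)

/-- The coefficient of `x^(1-α) ∂_x` in the field `V`. -/
def xiHat (α : ℝ) (V : PointField) : ℝ × ℝ × ℝ → ℝ := fun p => (V p).2.1 / p.2.1 ^ (1 - α)

/-- The coefficient of `∂_u` in the field `V`. -/
def etaHat (V : PointField) : ℝ × ℝ × ℝ → ℝ := fun p => (V p).2.2

lemma contDiffOn_tauHat {Ω : Set (ℝ × ℝ × ℝ)} (β : ℝ) {V : PointField} (hV : ContDiffOn ℝ ∞ V Ω)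
    (hpos : Ω ⊆ positiveRegion) : ContDiffOn ℝ ∞ (tauHat β V) Ω :=
  hV.fst.div (contDiff_fst.contDiffOn.rpow_const_of_ne fun _ hp => (hpos hp).1.ne')
    fun _ hp => (Real.rpow_pos_of_pos (hpos hp).1 _).ne'

lemma contDiffOn_xiHat {Ω : Set (ℝ × ℝ × ℝ)} (α : ℝ) {V : PointField} (hV : ContDiffOn ℝ ∞ V Ω)
    (hpos : Ω ⊆ positiveRegion) : ContDiffOn ℝ ∞ (xiHat α V) Ω :=
  hV.snd.fst.div (contDiff_snd.fst.contDiffOn.rpow_const_of_ne fun _ hp => (hpos hp).2.ne')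
    fun _ hp => (Real.rpow_pos_of_pos (hpos hp).2 _).ne'

lemma contDiffOn_etaHat {Ω : Set (ℝ × ℝ × ℝ)} {V : PointField} (hV : ContDiffOn ℝ ∞ V Ω) :
    ContDiffOn ℝ ∞ (etaHat V) Ω := hV.snd.snd

/-- The coefficient of the prolonged field belonging to `∂_t^β u`, in the jet variables. -/
def jetEtaT (α β : ℝ) (V : PointField) (p : ℝ × ℝ × ℝ) (P Q : ℝ) : ℝ :=
  (fieldDeriv (burgersV1 β) (etaHat V) p + P * fieldDeriv verticalField (etaHat V) p)
  - Q * (fieldDeriv (burgersV1 β) (xiHat α V) p + P * fieldDeriv verticalField (xiHat α V) p)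
  - P * (fieldDeriv (burgersV1 β) (tauHat β V) p + P * fieldDeriv verticalField (tauHat β V) p)

/-- The coefficient of the prolonged field belonging to `∂_x^α u`, in the jet variables. -/
def jetEtaX (α β : ℝ) (V : PointField) (p : ℝ × ℝ × ℝ) (P Q : ℝ) : ℝ :=
  (fieldDeriv (burgersV2 α) (etaHat V) p + Q * fieldDeriv verticalField (etaHat V) p)
  - Q * (fieldDeriv (burgersV2 α) (xiHat α V) p + Q * fieldDeriv verticalField (xiHat α V) p)
  - P * (fieldDeriv (burgersV2 α) (tauHat β V) p + Q * fieldDeriv verticalField (tauHat β V) p)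

/-- The second total `x`-derivative of order `α` of `f` apart from the term with the second
derivative of `u`. -/
def secondTotal (α : ℝ) (f : ℝ × ℝ × ℝ → ℝ) (p : ℝ × ℝ × ℝ) (Q : ℝ) : ℝ :=
  (fieldDeriv (burgersV2 α) (fieldDeriv (burgersV2 α) f) p
    + Q * fieldDeriv verticalField (fieldDeriv (burgersV2 α) f) p)
  + Q * (fieldDeriv (burgersV2 α) (fieldDeriv verticalField f) p
    + Q * fieldDeriv verticalField (fieldDeriv verticalField f) p)

/-- The coefficient of the prolonged field belonging to `∂_x^{2α} u`, in the jet variables. -/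
def jetEtaXX (α β : ℝ) (V : PointField) (p : ℝ × ℝ × ℝ) (P Q R S : ℝ) : ℝ :=
  (secondTotal α (etaHat V) p Q + R * fieldDeriv verticalField (etaHat V) p)
  - Q * (secondTotal α (xiHat α V) p Q + R * fieldDeriv verticalField (xiHat α V) p)
  - P * (secondTotal α (tauHat β V) p Q + R * fieldDeriv verticalField (tauHat β V) p)
  - 2 * R * (fieldDeriv (burgersV2 α) (xiHat α V) p + Q * fieldDeriv verticalField (xiHat α V) p)
  - 2 * S * (fieldDeriv (burgersV2 α) (tauHat β V) p
      + Q * fieldDeriv verticalField (tauHat β V) p)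

section Along

variable {Ω : Set (ℝ × ℝ × ℝ)} {U : Set (ℝ × ℝ)} {u : ℝ → ℝ → ℝ} {t x : ℝ}

/-- This is the total derivative in `T`, divided by the weight because the differentiation is in
`t`. -/
lemma hasDerivAt_alongT (α β : ℝ) (hΩ : IsOpen Ω) (hpos : Ω ⊆ positiveRegion) (hU : IsOpen U)
    (hu : ContDiffOn ℝ ∞ (fun p : ℝ × ℝ => u p.1 p.2) U)
    (hUΩ : ∀ t x : ℝ, (t, x) ∈ U → (t, x, u t x) ∈ Ω) (h : (t, x) ∈ U)
    {f : ℝ × ℝ × ℝ → ℝ} (hf : ContDiffOn ℝ ∞ f Ω) :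
    HasDerivAt (fun s => f (s, x, u s x)) ((fieldDeriv (burgersV1 β) f (t, x, u t x)
      + fracPartialT β u t x * fieldDeriv verticalField f (t, x, u t x)) / t ^ (1 - β)) t := by
  have hp := hUΩ t x h
  have hd := (hf.differentiableAt_of_isOpen hΩ hp).hasFDerivAt
  have hc : HasDerivAt (fun s : ℝ => (s, x, u s x)) (1, 0, partialT u t x) t :=
    (hasDerivAt_id t).prodMk ((hasDerivAt_const _ _).prodMk (hasDerivAt_partialT hU hu h))
  have H := HasFDerivAt.comp_hasDerivAt (f := fun s : ℝ => (s, x, u s x)) t hd hc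
  have hw := (Real.rpow_pos_of_pos (hpos hp).1 (1 - β)).ne'
  rw [apply_eq_of_mem_positiveRegion α β _ (hpos hp)] at H
  refine H.congr_deriv ?_
  rw [fracPartialT_eq β hU hu h]
  simp only [fieldDeriv] at *
  field_simp
  ring

lemma hasDerivAt_alongX (α β : ℝ) (hΩ : IsOpen Ω) (hpos : Ω ⊆ positiveRegion) (hU : IsOpen U)
    (hu : ContDiffOn ℝ ∞ (fun p : ℝ × ℝ => u p.1 p.2) U)
    (hUΩ : ∀ t x : ℝ, (t, x) ∈ U → (t, x, u t x) ∈ Ω) (h : (t, x) ∈ U)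
    {f : ℝ × ℝ × ℝ → ℝ} (hf : ContDiffOn ℝ ∞ f Ω) :
    HasDerivAt (fun y => f (t, y, u t y)) ((fieldDeriv (burgersV2 α) f (t, x, u t x)
      + fracPartialX α u t x * fieldDeriv verticalField f (t, x, u t x)) / x ^ (1 - α)) x := by
  have hp := hUΩ t x h
  have hd := (hf.differentiableAt_of_isOpen hΩ hp).hasFDerivAt
  have hc : HasDerivAt (fun y : ℝ => (t, y, u t y)) (0, 1, partialX u t x) x :=
    (hasDerivAt_const _ _).prodMk ((hasDerivAt_id x).prodMk (hasDerivAt_partialX hU hu h))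
  have H := HasFDerivAt.comp_hasDerivAt (f := fun y : ℝ => (t, y, u t y)) x hd hc
  have hw := (Real.rpow_pos_of_pos (hpos hp).2 (1 - α)).ne'
  rw [apply_eq_of_mem_positiveRegion α β _ (hpos hp)] at H
  refine H.congr_deriv ?_
  rw [fracPartialX_eq α hU hu h]
  simp only [fieldDeriv] at *
  field_simp
  ring

variable {V : PointField}

lemma tauAlong_eq (β : ℝ) (hpos : Ω ⊆ positiveRegion) (h : (t, x, u t x) ∈ Ω) :
    tauAlong V u t x = t ^ (1 - β) * tauHat β V (t, x, u t x) :=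
  (mul_div_cancel₀ _ (Real.rpow_pos_of_pos (hpos h).1 _).ne').symm

lemma xiAlong_eq (α : ℝ) (hpos : Ω ⊆ positiveRegion) (h : (t, x, u t x) ∈ Ω) :
    xiAlong V u t x = x ^ (1 - α) * xiHat α V (t, x, u t x) :=
  (mul_div_cancel₀ _ (Real.rpow_pos_of_pos (hpos h).2 _).ne').symm

/-- The correction `(1-β) τ t^(-β) u_t` cancels the term that comes from differentiating the weight
in `τ = t^(1-β) τ̂`, where `τ̂` is `tauHat`. What is left is the ordinary prolongation formula for
the frame coefficients. -/
lemma fracEtaT_eq (α β : ℝ) (hΩ : IsOpen Ω) (hpos : Ω ⊆ positiveRegion) (hU : IsOpen U)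
    (hu : ContDiffOn ℝ ∞ (fun p : ℝ × ℝ => u p.1 p.2) U)
    (hUΩ : ∀ t x : ℝ, (t, x) ∈ U → (t, x, u t x) ∈ Ω) (hV : ContDiffOn ℝ ∞ V Ω)
    (h : (t, x) ∈ U) :
    fracEtaT β V u t x =
      jetEtaT α β V (t, x, u t x) (fracPartialT β u t x) (fracPartialX α u t x) := by
  have hp := hUΩ t x h
  obtain ⟨ht, hx⟩ : 0 < t ∧ 0 < x := hpos hp
  have hw := (Real.rpow_pos_of_pos ht (1 - β)).ne'
  have hm := (Real.rpow_pos_of_pos hx (1 - α)).ne'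
  have along := fun {f} => hasDerivAt_alongT (f := f) α β hΩ hpos hU hu hUΩ h
  have hev := (eventually_mem_of_isOpen hU h).1
  have e1 : partialT (etaAlong V u) t x = _ := (along (contDiffOn_etaHat hV)).deriv
  have e2 : partialT (xiAlong V u) t x = _ :=
    (((along (contDiffOn_xiHat α hV hpos)).const_mul (x ^ (1 - α))).congr_of_eventuallyEq
      (hev.mono fun s hs => xiAlong_eq α hpos (hUΩ s x hs))).deriv
  have e3 : partialT (tauAlong V u) t x = _ :=
    (((Real.hasDerivAt_rpow_const (p := 1 - β) (Or.inl ht.ne')).mul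
      (along (contDiffOn_tauHat β hV hpos))).congr_of_eventuallyEq
      (hev.mono fun s hs => tauAlong_eq β hpos (hUΩ s x hs))).deriv
  rw [fracEtaT, etaT, e1, e2, e3, tauAlong_eq β hpos hp, jetEtaT, fracPartialX_eq α hU hu h,
    fracPartialT_eq β hU hu h, show 1 - β - 1 = -β by ring]
  field_simp
  ring

lemma fracEtaX_eq (α β : ℝ) (hΩ : IsOpen Ω) (hpos : Ω ⊆ positiveRegion) (hU : IsOpen U)
    (hu : ContDiffOn ℝ ∞ (fun p : ℝ × ℝ => u p.1 p.2) U)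
    (hUΩ : ∀ t x : ℝ, (t, x) ∈ U → (t, x, u t x) ∈ Ω) (hV : ContDiffOn ℝ ∞ V Ω)
    (h : (t, x) ∈ U) :
    fracEtaX α V u t x =
      jetEtaX α β V (t, x, u t x) (fracPartialT β u t x) (fracPartialX α u t x) := by
  have hp := hUΩ t x h
  obtain ⟨ht, hx⟩ : 0 < t ∧ 0 < x := hpos hp
  have hw := (Real.rpow_pos_of_pos ht (1 - β)).ne'
  have hm := (Real.rpow_pos_of_pos hx (1 - α)).ne'
  have along := fun {f} => hasDerivAt_alongX (f := f) α β hΩ hpos hU hu hUΩ h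
  have hev := (eventually_mem_of_isOpen hU h).2
  have e1 : partialX (etaAlong V u) t x = _ := (along (contDiffOn_etaHat hV)).deriv
  have e2 : partialX (xiAlong V u) t x = _ :=
    (((Real.hasDerivAt_rpow_const (p := 1 - α) (Or.inl hx.ne')).mul
      (along (contDiffOn_xiHat α hV hpos))).congr_of_eventuallyEq
      (hev.mono fun s hs => xiAlong_eq α hpos (hUΩ t s hs))).deriv
  have e3 : partialX (tauAlong V u) t x = _ :=
    (((along (contDiffOn_tauHat β hV hpos)).const_mul (t ^ (1 - β))).congr_of_eventuallyEq
      (hev.mono fun s hs => tauAlong_eq β hpos (hUΩ t s hs))).deriv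
  rw [fracEtaX, etaX, e1, e2, e3, xiAlong_eq α hpos hp, jetEtaX, fracPartialX_eq α hU hu h,
    fracPartialT_eq β hU hu h, show 1 - α - 1 = -α by ring]
  field_simp
  ring

/-- The second-order form of the same cancellation: the three correction terms absorb every
derivative of the weight `x^(1-α)`. -/
lemma fracEtaXX_eq (α β : ℝ) (hΩ : IsOpen Ω) (hpos : Ω ⊆ positiveRegion) (hU : IsOpen U)
    (hu : ContDiffOn ℝ ∞ (fun p : ℝ × ℝ => u p.1 p.2) U)
    (hUΩ : ∀ t x : ℝ, (t, x) ∈ U → (t, x, u t x) ∈ Ω) (hV : ContDiffOn ℝ ∞ V Ω)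
    (h : (t, x) ∈ U) :
    fracEtaXX α V u t x =
      jetEtaXX α β V (t, x, u t x) (fracPartialT β u t x) (fracPartialX α u t x)
        (fracPartialX α (fracPartialX α u) t x) (fracPartialX α (fracPartialT β u) t x) := by
  have hp := hUΩ t x h
  have hUpos : ∀ p ∈ U, 0 < p.1 ∧ 0 < p.2 := fun p hp => hpos (hUΩ p.1 p.2 hp)
  obtain ⟨ht, hx⟩ : 0 < t ∧ 0 < x := hpos hp
  have hw := (Real.rpow_pos_of_pos ht (1 - β)).ne'
  have along := fun {f} => hasDerivAt_alongX (f := f) α β hΩ hpos hU hu hUΩ h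
  have hev := (eventually_mem_of_isOpen hU h).2
  have hη := contDiffOn_etaHat hV
  have hξ := contDiffOn_xiHat α hV hpos
  have hτ := contDiffOn_tauHat β hV hpos
  have hV2 := (contDiffOn_burgersV2 α).mono hpos
  have hV3 := contDiffOn_verticalField Ω
  have hQs := contDiffOn_fracPartialX α hU (fun p hp => (hUpos p hp).2) hu
  have hPs := contDiffOn_fracPartialT β hU (fun p hp => (hUpos p hp).1) hu
  have hQ := hasDerivAt_fracPartialX α hU hx hQs h
  have hP := hasDerivAt_fracPartialX α hU hx hPs h
  have dm := Real.hasDerivAt_rpow_const (x := x) (p := 1 - α) (Or.inl hx.ne')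
  have e2 : partialX (xiAlong V u) t x = _ :=
    ((dm.mul (along hξ)).congr_of_eventuallyEq
      (hev.mono fun s hs => xiAlong_eq α hpos (hUΩ t s hs))).deriv
  have e3 : partialX (tauAlong V u) t x = _ :=
    (((along hτ).const_mul (t ^ (1 - β))).congr_of_eventuallyEq
      (hev.mono fun s hs => tauAlong_eq β hpos (hUΩ t s hs))).deriv
  have e4 : partialX (partialX u) t x = _ :=
    ((hQ.div dm (Real.rpow_pos_of_pos hx _).ne').congr_of_eventuallyEq
      (hev.mono fun y hy => by
        rw [Pi.div_apply, fracPartialX_eq α hU hu hy,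
          mul_div_cancel_left₀ _ (Real.rpow_pos_of_pos (hUpos _ hy).2 _).ne'])).deriv
  have e5 : partialX (partialT u) t x = _ :=
    ((hP.div_const (t ^ (1 - β))).congr_of_eventuallyEq
      (hev.mono fun y hy => by
        beta_reduce
        rw [fracPartialT_eq β hU hu hy, mul_div_cancel_left₀ _ hw])).deriv
  -- The derivative in `x` of `jetEtaX` along `u`, assembled term by term; the derivatives of `Q`
  -- and `P` bring in the jet variables `R` and `S`.
  have hA := (((along (hη.fieldDeriv hΩ hV2)).add (hQ.mul (along (hη.fieldDeriv hΩ hV3)))).sub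
    (hQ.mul ((along (hξ.fieldDeriv hΩ hV2)).add (hQ.mul (along (hξ.fieldDeriv hΩ hV3)))))).sub
    (hP.mul ((along (hτ.fieldDeriv hΩ hV2)).add (hQ.mul (along (hτ.fieldDeriv hΩ hV3)))))
  -- The first-order formula solved for `η^x`. It holds for all `y` near `x`, so it may be
  -- differentiated.
  have hetaX : ∀ y, (t, y) ∈ U → etaX V u t y =
      jetEtaX α β V (t, y, u t y) (fracPartialT β u t y) (fracPartialX α u t y) / y ^ (1 - α)
        - (1 - α) * (xiHat α V (t, y, u t y) * fracPartialX α u t y / y) := fun y hy => by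
    have hy0 : 0 < y := (hUpos _ hy).2
    have hk := (Real.rpow_pos_of_pos hy0 (1 - α)).ne'
    have hy1 : y ^ (-α) = y ^ (1 - α) / y := by
      rw [← Real.rpow_sub_one hy0.ne']
      ring_nf
    have := hy0.ne'
    rw [← fracEtaX_eq α β hΩ hpos hU hu hUΩ hV hy, fracEtaX, xiAlong_eq α hpos (hUΩ _ _ hy),
      fracPartialX_eq α hU hu hy, hy1]
    field_simp
    ring
  have e6 : partialX (etaX V u) t x = _ :=
    (((hA.div dm (Real.rpow_pos_of_pos hx _).ne').sub
      ((((along hξ).mul hQ).div (hasDerivAt_id x) hx.ne').const_mul (1 - α))).congr_of_eventuallyEq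
      (hev.mono hetaX)).deriv
  simp only [Pi.mul_apply, Pi.add_apply, Pi.sub_apply, id] at e2 e3 e4 e5 e6
  rw [fracEtaXX, etaXX, e6, e2, e3, e4, e5, hetaX x h, xiAlong_eq α hpos hp, jetEtaXX, jetEtaX,
    secondTotal, secondTotal, secondTotal]
  have hux : partialX u t x = fracPartialX α u t x / x ^ (1 - α) := by
    rw [fracPartialX_eq α hU hu h, mul_div_cancel_left₀ _ (Real.rpow_pos_of_pos hx _).ne']
  rw [hux]
  have r1 : x ^ (1 - α) = x / x ^ α := by rw [Real.rpow_sub hx, Real.rpow_one]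
  have r2 : x ^ (1 - α - 1) = 1 / x ^ α := by
    rw [show 1 - α - 1 = -α by ring, Real.rpow_neg hx.le, one_div]
  have r5 : x ^ (-(2 * α)) = 1 / (x ^ α) ^ 2 := by
    rw [Real.rpow_neg hx.le, two_mul, Real.rpow_add hx, sq, one_div]
  have r3 : x ^ (2 - 2 * α) = x ^ 2 / (x ^ α) ^ 2 := by
    rw [sub_eq_add_neg, Real.rpow_add hx, r5, Real.rpow_ofNat]; ring
  have r4 : x ^ (1 - 2 * α) = x / (x ^ α) ^ 2 := by
    rw [sub_eq_add_neg, Real.rpow_add hx, r5, Real.rpow_one]; ring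
  have hl := (Real.rpow_pos_of_pos hx α).ne'
  rw [r1, r2, r3, r4, r5]
  clear * - hl hx hw
  have hx' := hx.ne'
  generalize x ^ α = l at *
  generalize t ^ (1 - β) = w at *
  field_simp
  ring

end Along

/-! ### Lie's criterion as an identity in the jet variables. -/

lemma fderiv_burgers (a b : ℝ) (j v : Fin 6 → ℝ) :
    fderiv ℝ (burgers a b) j v = v 3 + a * (v 2 * j 4 + j 2 * v 4) + b * v 5 := by
  have h := fun i : Fin 6 => hasFDerivAt_apply (𝕜 := ℝ) i j
  have H : HasFDerivAt (burgers a b) _ j :=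
    ((h 3).add (((h 2).const_mul a).mul (h 4))).add ((h 5).const_mul b)
  rw [H.fderiv]
  simp
  ring

section TestFunction

variable (α β t₀ x₀ u₀ P Q R S : ℝ)

/-- A function with prescribed conformable jet at `(t₀, x₀)`. -/
def testFunction (t x : ℝ) : ℝ :=
  u₀ + P * (t ^ β / β - t₀ ^ β / β) + Q * (x ^ α / α - x₀ ^ α / α)
    + R / 2 * (x ^ α / α - x₀ ^ α / α) ^ 2
    + S * ((t ^ β / β - t₀ ^ β / β) * (x ^ α / α - x₀ ^ α / α))

variable {α β}

lemma hasDerivAt_rpow_div {γ : ℝ} (hγ : γ ≠ 0) {s : ℝ} (hs : 0 < s) (s₀ : ℝ) :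
    HasDerivAt (fun y : ℝ => y ^ γ / γ - s₀ ^ γ / γ) (1 / s ^ (1 - γ)) s := by
  refine (((Real.hasDerivAt_rpow_const (p := γ) (Or.inl hs.ne')).div_const γ).sub_const
    (s₀ ^ γ / γ)).congr_deriv ?_
  rw [mul_div_cancel_left₀ _ hγ, one_div, ← Real.rpow_neg hs.le, neg_sub]

lemma fracPartialT_testFunction (hβ : β ≠ 0) {t : ℝ} (ht : 0 < t) (x : ℝ) :
    fracPartialT β (testFunction α β t₀ x₀ u₀ P Q R S) t x =
      P + S * (x ^ α / α - x₀ ^ α / α) := by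
  have h := hasDerivAt_rpow_div hβ ht t₀
  have H := ((((h.const_mul P).const_add u₀).add_const (Q * (x ^ α / α - x₀ ^ α / α))).add_const
    (R / 2 * (x ^ α / α - x₀ ^ α / α) ^ 2)).add
      ((h.mul_const (x ^ α / α - x₀ ^ α / α)).const_mul S)
  refine (conformableDeriv_of_hasDerivAt β H).trans ?_
  have := (Real.rpow_pos_of_pos ht (1 - β)).ne'
  field_simp

lemma fracPartialX_testFunction (hα : α ≠ 0) {x : ℝ} (hx : 0 < x) (t : ℝ) :
    fracPartialX α (testFunction α β t₀ x₀ u₀ P Q R S) t x =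
      Q + R * (x ^ α / α - x₀ ^ α / α) + S * (t ^ β / β - t₀ ^ β / β) := by
  have h := hasDerivAt_rpow_div hα hx x₀
  have H := (((h.const_mul Q).const_add (u₀ + P * (t ^ β / β - t₀ ^ β / β))).add
    ((h.pow 2).const_mul (R / 2))).add
      ((h.const_mul (t ^ β / β - t₀ ^ β / β)).const_mul S)
  refine (conformableDeriv_of_hasDerivAt α H).trans ?_
  have := (Real.rpow_pos_of_pos hx (1 - α)).ne'
  simp only [Nat.cast_ofNat, Nat.add_one_sub_one, pow_one]
  generalize x ^ α / α - x₀ ^ α / α = X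
  generalize t ^ β / β - t₀ ^ β / β = T
  field_simp

lemma fracPartialX_fracPartialX_testFunction (hα : α ≠ 0) {x : ℝ} (hx : 0 < x) (t : ℝ) :
    fracPartialX α (fracPartialX α (testFunction α β t₀ x₀ u₀ P Q R S)) t x = R := by
  have h := hasDerivAt_rpow_div hα hx x₀
  have H := ((h.const_mul R).const_add Q).add_const (S * (t ^ β / β - t₀ ^ β / β))
  refine (conformableDeriv_of_hasDerivAt α (H.congr_of_eventuallyEq
    ((lt_mem_nhds hx).mono fun y hy =>
      fracPartialX_testFunction t₀ x₀ u₀ P Q R S hα hy t))).trans ?_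
  have := (Real.rpow_pos_of_pos hx (1 - α)).ne'
  field_simp

lemma fracPartialX_fracPartialT_testFunction (hα : α ≠ 0) (hβ : β ≠ 0) {t x : ℝ} (ht : 0 < t)
    (hx : 0 < x) :
    fracPartialX α (fracPartialT β (testFunction α β t₀ x₀ u₀ P Q R S)) t x = S := by
  have h := hasDerivAt_rpow_div hα hx x₀
  have H := (h.const_mul S).const_add P
  refine (conformableDeriv_of_hasDerivAt α (H.congr_of_eventuallyEq
    (Filter.Eventually.of_forall fun y =>
      fracPartialT_testFunction t₀ x₀ u₀ P Q R S hβ ht y))).trans ?_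
  have := (Real.rpow_pos_of_pos hx (1 - α)).ne'
  field_simp

lemma contDiffOn_testFunction {U : Set (ℝ × ℝ)} (hU : ∀ p ∈ U, 0 < p.1 ∧ 0 < p.2) :
    ContDiffOn ℝ ∞ (fun p : ℝ × ℝ => testFunction α β t₀ x₀ u₀ P Q R S p.1 p.2) U := by
  have ht : ContDiffOn ℝ ∞ (fun p : ℝ × ℝ => p.1 ^ β) U :=
    contDiff_fst.contDiffOn.rpow_const_of_ne fun p hp => (hU p hp).1.ne'
  have hx : ContDiffOn ℝ ∞ (fun p : ℝ × ℝ => p.2 ^ α) U :=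
    contDiff_snd.contDiffOn.rpow_const_of_ne fun p hp => (hU p hp).2.ne'
  unfold testFunction
  fun_prop

/-- Continuity is needed on the whole plane, so that the set where the graph lies in `Ω` is open;
nonnegative exponents make the real powers continuous everywhere. -/
lemma continuous_testFunction (hα : 0 ≤ α) (hβ : 0 ≤ β) :
    Continuous (fun p : ℝ × ℝ => testFunction α β t₀ x₀ u₀ P Q R S p.1 p.2) := by
  have ht : Continuous (fun p : ℝ × ℝ => p.1 ^ β) := continuous_fst.rpow_const fun _ => Or.inr hβ
  have hx : Continuous (fun p : ℝ × ℝ => p.2 ^ α) := continuous_snd.rpow_const fun _ => Or.inr hα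
  unfold testFunction
  fun_prop

end TestFunction

/-- The Lie symmetry condition as a polynomial identity in the jet variables. -/
lemma isLieSymmetry_burgers_iff (a b : ℝ) {α β : ℝ} (hα : 0 < α) (hβ : 0 < β)
    {Ω : Set (ℝ × ℝ × ℝ)} (hΩ : IsOpen Ω) (hpos : Ω ⊆ positiveRegion) (V : PointField) :
    IsLieSymmetry (burgers a b) α β Ω V ↔ ContDiffOn ℝ ∞ V Ω ∧
      ∀ p ∈ Ω, ∀ P Q R S : ℝ, P + a * p.2.2 * Q + b * R = 0 →
        jetEtaT α β V p P Q + a * (etaHat V p * Q + p.2.2 * jetEtaX α β V p P Q)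
          + b * jetEtaXX α β V p P Q R S = 0 := by
  refine and_congr_right fun hV => ⟨?_, ?_⟩
  · rintro H ⟨t₀, x₀, u₀⟩ hp P Q R S h0
    obtain ⟨ht, hx⟩ : 0 < t₀ ∧ 0 < x₀ := hpos hp
    set u := testFunction α β t₀ x₀ u₀ P Q R S with hu
    -- The largest set over which the graph of `u` lies in `Ω`; positivity of `t` and `x` on it is
    -- inherited from `Ω`.
    set U : Set (ℝ × ℝ) := {q | (q.1, q.2, u q.1 q.2) ∈ Ω} with hUdef
    have hU : IsOpen U := hΩ.preimage (continuous_fst.prodMk (continuous_snd.prodMk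
      (continuous_testFunction t₀ x₀ u₀ P Q R S hα.le hβ.le)))
    have hUΩ : ∀ t x : ℝ, (t, x) ∈ U → (t, x, u t x) ∈ Ω := fun t x h => h
    have hUpos : ∀ q ∈ U, 0 < q.1 ∧ 0 < q.2 := fun q hq => hpos hq
    have hus : ContDiffOn ℝ ∞ (fun q : ℝ × ℝ => u q.1 q.2) U :=
      contDiffOn_testFunction (α := α) (β := β) t₀ x₀ u₀ P Q R S hUpos
    have hu0 : u t₀ x₀ = u₀ := by simp [hu, testFunction]
    have hmem : (t₀, x₀) ∈ U := by
      change (t₀, x₀, u t₀ x₀) ∈ Ω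
      rwa [hu0]
    have e1 : fracPartialT β u t₀ x₀ = _ :=
      fracPartialT_testFunction (α := α) t₀ x₀ u₀ P Q R S hβ.ne' ht x₀
    have e2 : fracPartialX α u t₀ x₀ = _ :=
      fracPartialX_testFunction (β := β) t₀ x₀ u₀ P Q R S hα.ne' hx t₀
    have e3 : fracPartialX α (fracPartialX α u) t₀ x₀ = _ :=
      fracPartialX_fracPartialX_testFunction (β := β) t₀ x₀ u₀ P Q R S hα.ne' hx t₀
    have e4 : fracPartialX α (fracPartialT β u) t₀ x₀ = _ :=
      fracPartialX_fracPartialT_testFunction t₀ x₀ u₀ P Q R S hα.ne' hβ.ne' ht hx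
    simp only [sub_self, mul_zero, add_zero] at e1 e2
    have := H U u hU hus hUΩ t₀ x₀ hmem
    rw [fderiv_burgers] at this
    simp only [burgers, fracJet, fracProlongation, hu0,
      fracEtaT_eq α β hΩ hpos hU hus hUΩ hV hmem, fracEtaX_eq α β hΩ hpos hU hus hUΩ hV hmem,
      fracEtaXX_eq α β hΩ hpos hU hus hUΩ hV hmem, e1, e2, e3, e4] at this
    simpa [etaAlong, etaHat, hu0] using this h0
  · intro H U u hU hus hUΩ t x hmem h0
    have := H _ (hUΩ t x hmem) (fracPartialT β u t x) (fracPartialX α u t x)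
      (fracPartialX α (fracPartialX α u) t x) (fracPartialX α (fracPartialT β u) t x)
      (by simpa [burgers, fracJet] using h0)
    rw [fderiv_burgers]
    simp only [fracJet, fracProlongation,
      fracEtaT_eq α β hΩ hpos hU hus hUΩ hV hmem, fracEtaX_eq α β hΩ hpos hU hus hUΩ hV hmem,
      fracEtaXX_eq α β hΩ hpos hU hus hUΩ hV hmem]
    simpa [etaAlong, etaHat] using this

/-! ### Commutation of the frame and rules for derivatives along fields. -/

section Commute

variable {Ω : Set (ℝ × ℝ × ℝ)} {f : ℝ × ℝ × ℝ → ℝ}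

lemma fieldDeriv_burgersV1_burgersV2 {α β : ℝ} (hα : α ≠ 0) (hβ : β ≠ 0) (hΩ : IsOpen Ω)
    (hpos : Ω ⊆ positiveRegion) (hf : ContDiffOn ℝ ∞ f Ω) : ∀ p ∈ Ω,
    fieldDeriv (burgersV1 β) (fieldDeriv (burgersV2 α) f) p =
      fieldDeriv (burgersV2 α) (fieldDeriv (burgersV1 β) f) p := by
  refine fieldDeriv_comm hΩ hf ((contDiffOn_burgersV1 β).mono hpos)
    ((contDiffOn_burgersV2 α).mono hpos) fun p hp => ?_
  -- The constant `a` does not enter `V₁` and `V₂`, so any nonzero value serves; here it is `1`.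
  rw [burgersV1_eq 1 α, burgersV2_eq 1 α β,
    lieBracket_burgersField one_ne_zero hα hβ _ _ _ _ _ _ _ _ _ _ (hpos hp)]
  simp [burgersField]

lemma fieldDeriv_burgersV1_verticalField (β : ℝ) (hΩ : IsOpen Ω)
    (hpos : Ω ⊆ positiveRegion) (hf : ContDiffOn ℝ ∞ f Ω) : ∀ p ∈ Ω,
    fieldDeriv (burgersV1 β) (fieldDeriv verticalField f) p =
      fieldDeriv verticalField (fieldDeriv (burgersV1 β) f) p := by
  refine fieldDeriv_comm hΩ hf ((contDiffOn_burgersV1 β).mono hpos)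
    (contDiffOn_verticalField Ω) fun p hp => ?_
  rw [VectorField.lieBracket, burgersV1_eq 1 1, fderiv_burgersField _ _ _ _ _ _ _ _ (hpos hp)]
  unfold verticalField
  simp

lemma fieldDeriv_burgersV2_verticalField (α : ℝ) (hΩ : IsOpen Ω)
    (hpos : Ω ⊆ positiveRegion) (hf : ContDiffOn ℝ ∞ f Ω) : ∀ p ∈ Ω,
    fieldDeriv (burgersV2 α) (fieldDeriv verticalField f) p =
      fieldDeriv verticalField (fieldDeriv (burgersV2 α) f) p := by
  refine fieldDeriv_comm hΩ hf ((contDiffOn_burgersV2 α).mono hpos)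
    (contDiffOn_verticalField Ω) fun p hp => ?_
  rw [VectorField.lieBracket, burgersV2_eq 1 α 1, fderiv_burgersField _ _ _ _ _ _ _ _ (hpos hp)]
  unfold verticalField
  simp

end Commute

section Rules

variable {V : PointField} {f g h : ℝ × ℝ × ℝ → ℝ} {p : ℝ × ℝ × ℝ}

lemma fieldDeriv_const_mul (c : ℝ) (hf : DifferentiableAt ℝ f p) :
    fieldDeriv V (fun q => c * f q) p = c * fieldDeriv V f p := by
  simp [fieldDeriv, fderiv_const_mul hf]

/-- The shape is that of `η` after `eta_eq` is solved for it; this rule differentiates that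
expression along each field of the frame. -/
lemma fieldDeriv_combination (c d : ℝ) (hf : DifferentiableAt ℝ f p) (hg : DifferentiableAt ℝ g p)
    (hh : DifferentiableAt ℝ h p) :
    fieldDeriv V (fun q => c * f q - q.2.2 * (1 / 2 * g q) - d * h q) p =
      c * fieldDeriv V f p - (p.2.2 * (1 / 2 * fieldDeriv V g p) + 1 / 2 * g p * (V p).2.2)
        - d * fieldDeriv V h p := by
  have hu := (hasFDerivAt_snd (𝕜 := ℝ) (E := ℝ) (F := ℝ × ℝ) (p := p)).snd
  have H : fderiv ℝ (fun q => c * f q - q.2.2 * (1 / 2 * g q) - d * h q) p = _ :=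
    (((hf.hasFDerivAt.const_mul c).sub (hu.mul (hg.hasFDerivAt.const_mul (1 / 2)))).sub
      (hh.hasFDerivAt.const_mul d)).fderiv
  rw [fieldDeriv, H]
  simp [fieldDeriv]

end Rules

/-! ### The determining equations and their solution. -/

section Determining

variable {a b α β : ℝ} {Ω : Set (ℝ × ℝ × ℝ)} {V : PointField}

/-- The determining equations for the coefficients of `V` with respect to `t^(1-β) ∂_t`,
`x^(1-α) ∂_x` and `∂_u`. -/
structure DeterminingEquations (a b α β : ℝ) (Ω : Set (ℝ × ℝ × ℝ)) (τ ξ η : ℝ × ℝ × ℝ → ℝ) :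
    Prop where
  tau_x : ∀ p ∈ Ω, fieldDeriv (burgersV2 α) τ p = 0
  tau_u : ∀ p ∈ Ω, fieldDeriv verticalField τ p = 0
  xi_u : ∀ p ∈ Ω, fieldDeriv verticalField ξ p = 0
  tau_t : ∀ p ∈ Ω, fieldDeriv (burgersV1 β) τ p = 2 * fieldDeriv (burgersV2 α) ξ p
  eta_uu : ∀ p ∈ Ω, fieldDeriv verticalField (fieldDeriv verticalField η) p = 0
  eta_eq : ∀ p ∈ Ω, a * η p = fieldDeriv (burgersV1 β) ξ p
    - a * p.2.2 * fieldDeriv (burgersV2 α) ξ p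
    - b * (fieldDeriv (burgersV2 α) (fieldDeriv verticalField η) p
      + fieldDeriv verticalField (fieldDeriv (burgersV2 α) η) p)
    + b * fieldDeriv (burgersV2 α) (fieldDeriv (burgersV2 α) ξ) p
  eta_t : ∀ p ∈ Ω, fieldDeriv (burgersV1 β) η p + a * p.2.2 * fieldDeriv (burgersV2 α) η p
    + b * fieldDeriv (burgersV2 α) (fieldDeriv (burgersV2 α) η) p = 0

lemma IsLieSymmetry.determiningEquations (hb : b ≠ 0) (hα : 0 < α) (hβ : 0 < β) (hΩ : IsOpen Ω)
    (hpos : Ω ⊆ positiveRegion) (h : IsLieSymmetry (burgers a b) α β Ω V) :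
    DeterminingEquations a b α β Ω (tauHat β V) (xiHat α V) (etaHat V) := by
  rw [isLieSymmetry_burgers_iff a b hα hβ hΩ hpos] at h
  obtain ⟨hV, H⟩ := h
  have hξ := contDiffOn_xiHat α hV hpos
  -- `P` is eliminated by the equation; `Q`, `R`, `S` stay free, so coefficients can be isolated by
  -- differences of special values.
  have E : ∀ p ∈ Ω, ∀ Q R S : ℝ, _ := fun p hp Q R S =>
    H p hp (-(a * p.2.2 * Q + b * R)) Q R S (by ring)
  simp only [jetEtaT, jetEtaX, jetEtaXX] at E
  -- `S` occurs only in `-2 b S (τ_X + Q τ_u)`; the values `Q = 0` and `Q = 1` separate the two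
  -- derivatives.
  have htx : ∀ p ∈ Ω, fieldDeriv (burgersV2 α) (tauHat β V) p = 0 := fun p hp => by
    apply mul_left_cancel₀ (mul_ne_zero two_ne_zero hb)
    linear_combination E p hp 0 0 0 - E p hp 0 0 1
  have htu : ∀ p ∈ Ω, fieldDeriv verticalField (tauHat β V) p = 0 := fun p hp => by
    apply mul_left_cancel₀ (mul_ne_zero two_ne_zero hb)
    linear_combination E p hp 1 0 0 - E p hp 1 0 1 - 2 * b * htx p hp
  have htxx := fieldDeriv_eq_zero (V := burgersV2 α) hΩ htx
  have htux := fieldDeriv_eq_zero (V := verticalField) hΩ htx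
  have htxu := fieldDeriv_eq_zero (V := burgersV2 α) hΩ htu
  have htuu := fieldDeriv_eq_zero (V := verticalField) hΩ htu
  have E' : ∀ p ∈ Ω, ∀ Q R : ℝ, _ := fun p hp Q R => E p hp Q R 0
  simp +contextual only [secondTotal, htx, htu, htxx, htux, htxu, htuu] at E'
  -- The mixed difference picks out the coefficient of `Q R`, which is `-2 b ξ_u`.
  have hxu : ∀ p ∈ Ω, fieldDeriv verticalField (xiHat α V) p = 0 := fun p hp => by
    apply mul_left_cancel₀ (mul_ne_zero two_ne_zero hb)
    linear_combination E' p hp 1 0 + E' p hp 0 1 - E' p hp 1 1 - E' p hp 0 0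
  have hxxu := fieldDeriv_eq_zero (V := burgersV2 α) hΩ hxu
  have hxuu := fieldDeriv_eq_zero (V := verticalField) hΩ hxu
  have hxux : ∀ p ∈ Ω, fieldDeriv verticalField (fieldDeriv (burgersV2 α) (xiHat α V)) p = 0 :=
    fun p hp => by rw [← fieldDeriv_burgersV2_verticalField α hΩ hpos hξ p hp, hxxu p hp]
  simp +contextual only [hxu, hxxu, hxuu, hxux] at E'
  have htt : ∀ p ∈ Ω, fieldDeriv (burgersV1 β) (tauHat β V) p =
      2 * fieldDeriv (burgersV2 α) (xiHat α V) p := fun p hp => by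
    apply mul_left_cancel₀ hb
    linear_combination E' p hp 0 1 - E' p hp 0 0
  -- The last three equations are the coefficients of `Q²`, `Q` and `1` at `R = 0`, obtained from
  -- the even and odd parts in `Q`.
  refine ⟨htx, htu, hxu, htt, fun p hp => ?_, fun p hp => ?_, fun p hp => ?_⟩
  · apply mul_left_cancel₀ hb
    linear_combination (E' p hp 1 0 + E' p hp (-1) 0) / 2 - E' p hp 0 0
  · linear_combination (E' p hp 1 0 - E' p hp (-1) 0) / 2 - a * p.2.2 * htt p hp
  · linear_combination E' p hp 0 0

lemma DeterminingEquations.isLieSymmetry (hα : 0 < α) (hβ : 0 < β) (hΩ : IsOpen Ω)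
    (hpos : Ω ⊆ positiveRegion) (hV : ContDiffOn ℝ ∞ V Ω)
    (h : DeterminingEquations a b α β Ω (tauHat β V) (xiHat α V) (etaHat V)) :
    IsLieSymmetry (burgers a b) α β Ω V := by
  rw [isLieSymmetry_burgers_iff a b hα hβ hΩ hpos]
  refine ⟨hV, fun p hp P Q R S h0 => ?_⟩
  have hξ := contDiffOn_xiHat α hV hpos
  have hxux := fieldDeriv_burgersV2_verticalField α hΩ hpos hξ p hp
  rw [fieldDeriv_eq_zero hΩ h.xi_u p hp] at hxux
  simp only [jetEtaT, jetEtaX, jetEtaXX, secondTotal, h.tau_x p hp, h.tau_u p hp, h.xi_u p hp,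
    h.eta_uu p hp, h.tau_t p hp, fieldDeriv_eq_zero hΩ h.tau_x p hp,
    fieldDeriv_eq_zero hΩ h.tau_u p hp, fieldDeriv_eq_zero hΩ h.xi_u p hp, ← hxux]
  -- Modulo the determining equations, `pr V (Δ) = (η_u - 2 ξ_X) Δ`.
  linear_combination Q * h.eta_eq p hp + h.eta_t p hp
    + (fieldDeriv verticalField (etaHat V) p - 2 * fieldDeriv (burgersV2 α) (xiHat α V) p) * h0

/-- The solutions of the determining equations on a connected set. -/
lemma DeterminingEquations.exists_eq_quadPoly {τ ξ η : ℝ × ℝ × ℝ → ℝ} (ha : a ≠ 0)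
    (hα : α ≠ 0) (hβ : β ≠ 0) (hΩ : IsOpen Ω) (hΩc : IsPreconnected Ω)
    (hpos : Ω ⊆ positiveRegion) (hτ : ContDiffOn ℝ ∞ τ Ω) (hξ : ContDiffOn ℝ ∞ ξ Ω)
    (hη : ContDiffOn ℝ ∞ η Ω) (h : DeterminingEquations a b α β Ω τ ξ η) :
    ∃ c₁ c₂ c₃ c₄ c₅ : ℝ, ∀ p ∈ Ω,
      τ p = quadPoly α β c₄ (-2 * c₂) 0 0 c₁ 0 0 p ∧
      ξ p = quadPoly α β c₅ (a * c₃) (-c₂) 0 0 c₁ 0 p ∧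
      η p = quadPoly α β c₃ 0 (c₁ / a) c₂ 0 0 (-c₁) p := by
  have hV1 := (contDiffOn_burgersV1 β).mono hpos
  have hV2 := (contDiffOn_burgersV2 α).mono hpos
  have hV3 := contDiffOn_verticalField Ω
  have c12 := fun {f} => fieldDeriv_burgersV1_burgersV2 (f := f) hα hβ hΩ hpos
  have c13 := fun {f} => fieldDeriv_burgersV1_verticalField (f := f) β hΩ hpos
  have c23 := fun {f} => fieldDeriv_burgersV2_verticalField (f := f) α hΩ hpos
  obtain ⟨tau_x, tau_u, xi_u, tau_t, eta_uu, eta_eq, eta_t⟩ := h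
  have s1 := fun {f} (hf : ContDiffOn ℝ ∞ f Ω) => hf.fieldDeriv hΩ hV1
  have s2 := fun {f} (hf : ContDiffOn ℝ ∞ f Ω) => hf.fieldDeriv hΩ hV2
  have s3 := fun {f} (hf : ContDiffOn ℝ ∞ f Ω) => hf.fieldDeriv hΩ hV3
  have diff := fun {f : ℝ × ℝ × ℝ → ℝ} (hf : ContDiffOn ℝ ∞ f Ω) {p} (hp : p ∈ Ω) =>
    hf.differentiableAt_of_isOpen hΩ hp
  have z1 := fun {f} => fieldDeriv_eq_zero (V := burgersV1 β) (f := f) hΩ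
  have z2 := fun {f} => fieldDeriv_eq_zero (V := burgersV2 α) (f := f) hΩ
  set D1 := fieldDeriv (burgersV1 β)
  set D2 := fieldDeriv (burgersV2 α)
  set D3 := fieldDeriv verticalField
  have tau_xt : ∀ p ∈ Ω, D2 (D1 τ) p = 0 := fun p hp => (c12 hτ p hp).symm.trans (z1 tau_x p hp)
  have tau_ut : ∀ p ∈ Ω, D3 (D1 τ) p = 0 := fun p hp => (c13 hτ p hp).symm.trans (z1 tau_u p hp)
  have tau_xtt : ∀ p ∈ Ω, D2 (D1 (D1 τ)) p = 0 := fun p hp =>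
    (c12 (s1 hτ) p hp).symm.trans (z1 tau_xt p hp)
  have tau_utt : ∀ p ∈ Ω, D3 (D1 (D1 τ)) p = 0 := fun p hp =>
    (c13 (s1 hτ) p hp).symm.trans (z1 tau_ut p hp)
  have xi_ut : ∀ p ∈ Ω, D3 (D1 ξ) p = 0 := fun p hp => (c13 hξ p hp).symm.trans (z1 xi_u p hp)
  have xi_x : ∀ p ∈ Ω, D2 ξ p = 1 / 2 * D1 τ p := fun p hp => by rw [tau_t p hp]; ring
  have xi_xx : ∀ p ∈ Ω, D2 (D2 ξ) p = 0 := fun p hp => by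
    rw [show D2 (D2 ξ) p = D2 (fun q => 1 / 2 * D1 τ q) p from fieldDeriv_congr hΩ xi_x hp,
      show D2 (fun q => 1 / 2 * D1 τ q) p = _ from fieldDeriv_const_mul _ (diff (s1 hτ) hp)]
    change 1 / 2 * D2 (D1 τ) p = 0
    rw [tau_xt p hp, mul_zero]
  have xi_xt : ∀ p ∈ Ω, D2 (D1 ξ) p = 1 / 2 * D1 (D1 τ) p := fun p hp => by
    rw [← c12 hξ p hp]
    exact (fieldDeriv_congr hΩ xi_x hp).trans (fieldDeriv_const_mul _ (diff (s1 hτ) hp))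
  have eta_uxu : ∀ p ∈ Ω, D3 (D2 (D3 η)) p = 0 := fun p hp =>
    (c23 (s3 hη) p hp).symm.trans (z2 eta_uu p hp)
  -- `η` still occurs on the right through `η_uX`. This is harmless: its `u`-derivative vanishes by
  -- `eta_uu`, so that `η_u = -τ_T / 2`, and then `η_uX = 0`.
  have eta_eq' : Set.EqOn η (fun p => a⁻¹ * D1 ξ p - p.2.2 * (1 / 2 * D1 τ p)
      - (2 * b / a) * D2 (D3 η) p) Ω := fun p hp => by
    have h1 := eta_eq p hp
    rw [xi_x p hp, xi_xx p hp, ← c23 hη p hp] at h1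
    apply mul_left_cancel₀ ha
    rw [h1]
    field_simp
    ring
  have eta_u : ∀ p ∈ Ω, D3 η p = -(1 / 2) * D1 τ p := fun p hp => by
    have h1 := (fieldDeriv_congr hΩ eta_eq' hp).trans (fieldDeriv_combination (V := verticalField)
      a⁻¹ (2 * b / a) (diff (s1 hξ) hp) (diff (s1 hτ) hp) (diff (s2 (s3 hη)) hp))
    change D3 η p = a⁻¹ * D3 (D1 ξ) p - (p.2.2 * (1 / 2 * D3 (D1 τ) p) + 1 / 2 * D1 τ p * 1)
      - 2 * b / a * D3 (D2 (D3 η)) p at h1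
    rw [h1, xi_ut p hp, tau_ut p hp, eta_uxu p hp]
    ring
  have eta_xu : ∀ p ∈ Ω, D2 (D3 η) p = 0 := fun p hp => by
    rw [show D2 (D3 η) p = -(1 / 2) * D2 (D1 τ) p from
      (fieldDeriv_congr hΩ eta_u hp).trans (fieldDeriv_const_mul _ (diff (s1 hτ) hp)),
      tau_xt p hp, mul_zero]
  have eta_x : ∀ p ∈ Ω, D2 η p = a⁻¹ / 2 * D1 (D1 τ) p := fun p hp => by
    have h1 := (fieldDeriv_congr hΩ eta_eq' hp).trans (fieldDeriv_combination (V := burgersV2 α)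
      a⁻¹ (2 * b / a) (diff (s1 hξ) hp) (diff (s1 hτ) hp) (diff (s2 (s3 hη)) hp))
    change D2 η p = a⁻¹ * D2 (D1 ξ) p - (p.2.2 * (1 / 2 * D2 (D1 τ) p) + 1 / 2 * D1 τ p * 0)
      - 2 * b / a * D2 (D2 (D3 η)) p at h1
    rw [h1, xi_xt p hp, tau_xt p hp, z2 eta_xu p hp]
    ring
  have eta_xx : ∀ p ∈ Ω, D2 (D2 η) p = 0 := fun p hp => by
    rw [show D2 (D2 η) p = a⁻¹ / 2 * D2 (D1 (D1 τ)) p from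
      (fieldDeriv_congr hΩ eta_x hp).trans (fieldDeriv_const_mul _ (diff (s1 (s1 hτ)) hp)),
      tau_xtt p hp, mul_zero]
  -- In `eta_t` the terms `∓ u τ_TT / 2` from `η_T` and `a u η_X` cancel, leaving `ξ_TT / a = 0`.
  have xi_tt : ∀ p ∈ Ω, D1 (D1 ξ) p = 0 := fun p hp => by
    have h1 := (fieldDeriv_congr hΩ eta_eq' hp).trans (fieldDeriv_combination (V := burgersV1 β)
      a⁻¹ (2 * b / a) (diff (s1 hξ) hp) (diff (s1 hτ) hp) (diff (s2 (s3 hη)) hp))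
    change D1 η p = a⁻¹ * D1 (D1 ξ) p - (p.2.2 * (1 / 2 * D1 (D1 τ) p) + 1 / 2 * D1 τ p * 0)
      - 2 * b / a * D1 (D2 (D3 η)) p at h1
    have h2 := eta_t p hp
    rw [h1, z1 eta_xu p hp, eta_x p hp, eta_xx p hp] at h2
    field_simp at h2
    linarith
  -- `ξ_XTT` equals `τ_TTT / 2` and also vanishes with `ξ_TT`.
  have tau_ttt : ∀ p ∈ Ω, D1 (D1 (D1 τ)) p = 0 := fun p hp => by
    have h1 : D1 (D2 (D1 ξ)) p = 1 / 2 * D1 (D1 (D1 τ)) p :=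
      (fieldDeriv_congr hΩ xi_xt hp).trans (fieldDeriv_const_mul _ (diff (s1 (s1 hτ)) hp))
    rw [c12 (s1 hξ) p hp, z2 xi_tt p hp] at h1
    linarith
  -- Integration runs from the highest derivative down: `τ_TT`, `τ_T`, `τ`, then `ξ_T`, `ξ`, each
  -- time with one new constant.
  have integrate := fun {f} k₁ k₂ k₃ k₄ k₅ k₆ hf =>
    _root_.exists_eq_quadPoly k₁ k₂ k₃ k₄ k₅ k₆ hΩ hΩc hpos hα hβ (f := f) hf
  obtain ⟨k, hk⟩ := integrate 0 0 0 0 0 0 (s1 (s1 hτ))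
    (fun p hp => (tau_ttt p hp).trans (by simp [quadPoly]))
    (fun p hp => (tau_xtt p hp).trans (by simp [quadPoly]))
    (fun p hp => (tau_utt p hp).trans (by simp [quadPoly]))
  obtain ⟨l, hl⟩ := integrate k 0 0 0 0 0 (s1 hτ)
    (fun p hp => (hk p hp).trans (by simp [quadPoly]))
    (fun p hp => (tau_xt p hp).trans (by simp [quadPoly]))
    (fun p hp => (tau_ut p hp).trans (by simp [quadPoly]))
  obtain ⟨c₄, hc₄⟩ := integrate l 0 0 (k / 2) 0 0 hτ
    (fun p hp => (hl p hp).trans (by simp only [quadPoly]; ring))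
    (fun p hp => (tau_x p hp).trans (by simp [quadPoly]))
    (fun p hp => (tau_u p hp).trans (by simp [quadPoly]))
  obtain ⟨m, hm⟩ := integrate 0 (k / 2) 0 0 0 0 (s1 hξ)
    (fun p hp => (xi_tt p hp).trans (by simp [quadPoly]))
    (fun p hp => (xi_xt p hp).trans (by rw [hk p hp]; simp only [quadPoly]; ring))
    (fun p hp => (xi_ut p hp).trans (by simp [quadPoly]))
  obtain ⟨c₅, hc₅⟩ := integrate m (l / 2) 0 0 (k / 2) 0 hξ
    (fun p hp => (hm p hp).trans (by simp [quadPoly]))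
    (fun p hp => (xi_x p hp).trans (by rw [hl p hp]; simp only [quadPoly]; ring))
    (fun p hp => (xi_u p hp).trans (by simp [quadPoly]))
  -- Here `τ_TT = k`, while `l` and `m` are the constant terms of `τ_T` and `ξ_T`; they are `2 c₁`,
  -- `-2 c₂` and `a c₃`.
  refine ⟨k / 2, -l / 2, m / a, c₄, c₅, fun p hp => ⟨?_, ?_, ?_⟩⟩
  · rw [hc₄ p hp]
    simp only [quadPoly]
    ring
  · rw [hc₅ p hp]
    simp only [quadPoly]
    field_simp
  · rw [eta_eq' hp]
    beta_reduce
    rw [hm p hp, hl p hp, eta_xu p hp]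
    simp only [quadPoly]
    field_simp
    ring

lemma determiningEquations_quadPoly (ha : a ≠ 0) (hα : α ≠ 0) (hβ : β ≠ 0) (hΩ : IsOpen Ω)
    (hpos : Ω ⊆ positiveRegion) {τ ξ η : ℝ × ℝ × ℝ → ℝ} {c₁ c₂ c₃ c₄ c₅ : ℝ}
    (hτ : Set.EqOn τ (quadPoly α β c₄ (-2 * c₂) 0 0 c₁ 0 0) Ω)
    (hξ : Set.EqOn ξ (quadPoly α β c₅ (a * c₃) (-c₂) 0 0 c₁ 0) Ω)
    (hη : Set.EqOn η (quadPoly α β c₃ 0 (c₁ / a) c₂ 0 0 (-c₁)) Ω) :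
    DeterminingEquations a b α β Ω τ ξ η := by
  have d1 : ∀ {f k₀ k₁ k₂ k₃ k₄ k₅ k₆}, Set.EqOn f (quadPoly α β k₀ k₁ k₂ k₃ k₄ k₅ k₆) Ω →
      Set.EqOn (fieldDeriv (burgersV1 β) f) (quadPoly α β k₁ (2 * k₄) k₅ k₆ 0 0 0) Ω :=
    fun h p hp => (fieldDeriv_congr hΩ h hp).trans
      (fieldDeriv_burgersV1_quadPoly _ _ _ _ _ _ _ hβ (hpos hp))
  have d2 : ∀ {f k₀ k₁ k₂ k₃ k₄ k₅ k₆}, Set.EqOn f (quadPoly α β k₀ k₁ k₂ k₃ k₄ k₅ k₆) Ω →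
      Set.EqOn (fieldDeriv (burgersV2 α) f) (quadPoly α β k₂ k₅ 0 0 0 0 0) Ω :=
    fun h p hp => (fieldDeriv_congr hΩ h hp).trans
      (fieldDeriv_burgersV2_quadPoly _ _ _ _ _ _ _ hα (hpos hp))
  have d3 : ∀ {f k₀ k₁ k₂ k₃ k₄ k₅ k₆}, Set.EqOn f (quadPoly α β k₀ k₁ k₂ k₃ k₄ k₅ k₆) Ω →
      Set.EqOn (fieldDeriv verticalField f) (quadPoly α β k₃ k₆ 0 0 0 0 0) Ω :=
    fun h p hp => (fieldDeriv_congr hΩ h hp).trans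
      (fieldDeriv_verticalField_quadPoly _ _ _ _ _ _ _ (hpos hp))
  constructor <;> intro p hp
  · simp [d2 hτ hp, quadPoly]
  · simp [d3 hτ hp, quadPoly]
  · simp [d3 hξ hp, quadPoly]
  · simp only [d1 hτ hp, d2 hξ hp, quadPoly]
    ring
  · simp [d3 (d3 hη) hp, quadPoly]
  · simp only [hη hp, d1 hξ hp, d2 hξ hp, d2 (d3 hη) hp, d3 (d2 hη) hp, d2 (d2 hξ) hp, quadPoly]
    field_simp
    ring
  · simp only [d1 hη hp, d2 hη hp, d2 (d2 hη) hp, quadPoly]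
    field_simp
    ring

/-- A field agrees with `burgersField` at a point exactly if its coefficients with respect to
`t^(1-β) ∂_t`, `x^(1-α) ∂_x` and `∂_u` are the corresponding polynomials. -/
lemma eq_burgersField_iff (ha : a ≠ 0) (hα : α ≠ 0) (hβ : β ≠ 0) (c₁ c₂ c₃ c₄ c₅ : ℝ)
    {p : ℝ × ℝ × ℝ} (hp : p ∈ positiveRegion) :
    V p = burgersField a α β c₁ c₂ c₃ c₄ c₅ p ↔
      tauHat β V p = quadPoly α β c₄ (-2 * c₂) 0 0 c₁ 0 0 p ∧
      xiHat α V p = quadPoly α β c₅ (a * c₃) (-c₂) 0 0 c₁ 0 p ∧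
      etaHat V p = quadPoly α β c₃ 0 (c₁ / a) c₂ 0 0 (-c₁) p := by
  obtain ⟨t, x, u⟩ := p
  obtain ⟨ht, hx⟩ : 0 < t ∧ 0 < x := hp
  have e1 : t ^ (1 + β) = t * t ^ β := by rw [Real.rpow_add ht, Real.rpow_one]
  have e2 : t ^ (1 - β) = t / t ^ β := by rw [Real.rpow_sub ht, Real.rpow_one]
  have e3 : x ^ (1 - α) = x / x ^ α := by rw [Real.rpow_sub hx, Real.rpow_one]
  have hk := (Real.rpow_pos_of_pos ht β).ne'
  have hl := (Real.rpow_pos_of_pos hx α).ne'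
  have ht' := ht.ne'
  have hx' := hx.ne'
  rw [Prod.ext_iff, Prod.ext_iff]
  simp only [burgersField, tauHat, xiHat, etaHat, quadPoly, e1, e2, e3]
  generalize t ^ β = k at *
  generalize x ^ α = l at *
  rw [div_eq_iff (by positivity), div_eq_iff (by positivity)]
  refine and_congr ?_ (and_congr ?_ ?_)
  · rw [← sub_eq_zero, ← sub_eq_zero (b := _ * _)]
    refine Eq.congr (congrArg _ ?_) rfl
    field_simp
    ring
  · refine Eq.congr rfl ?_
    field_simp
    ring
  · refine Eq.congr rfl ?_
    field_simp
    ring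

lemma isLieSymmetry_burgers_iff_exists (ha : a ≠ 0) (hb : b ≠ 0) (hα : 0 < α) (hβ : 0 < β)
    (hΩ : IsOpen Ω) (hΩc : IsPreconnected Ω) (hpos : Ω ⊆ positiveRegion) (V : PointField) :
    IsLieSymmetry (burgers a b) α β Ω V ↔
      ∃ c₁ c₂ c₃ c₄ c₅ : ℝ, Set.EqOn V (burgersField a α β c₁ c₂ c₃ c₄ c₅) Ω := by
  constructor
  · intro h
    have hV := h.1
    obtain ⟨c₁, c₂, c₃, c₄, c₅, hc⟩ := (h.determiningEquations hb hα hβ hΩ hpos).exists_eq_quadPoly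
      ha hα.ne' hβ.ne' hΩ hΩc hpos (contDiffOn_tauHat β hV hpos) (contDiffOn_xiHat α hV hpos)
      (contDiffOn_etaHat hV)
    exact ⟨c₁, c₂, c₃, c₄, c₅, fun p hp =>
      (eq_burgersField_iff ha hα.ne' hβ.ne' c₁ c₂ c₃ c₄ c₅ (hpos hp)).2 (hc p hp)⟩
  · rintro ⟨c₁, c₂, c₃, c₄, c₅, h⟩
    have hc := fun p (hp : p ∈ Ω) =>
      (eq_burgersField_iff ha hα.ne' hβ.ne' c₁ c₂ c₃ c₄ c₅ (hpos hp)).1 (h hp)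
    exact (determiningEquations_quadPoly ha hα.ne' hβ.ne' hΩ hpos (fun p hp => (hc p hp).1)
      (fun p hp => (hc p hp).2.1) (fun p hp => (hc p hp).2.2)).isLieSymmetry hα hβ hΩ hpos
      (((contDiffOn_burgersField a α β c₁ c₂ c₃ c₄ c₅).mono hpos).congr h)

end Determining

/-! ### Independence of the five fields. -/

lemma sum_smul_burgersFields (a α β : ℝ) (c : Fin 5 → ℝ) (p : ℝ × ℝ × ℝ) :
    ∑ i, c i • burgersFields a α β i p =
      burgersField a α β (c 4) (c 3) (c 2) (c 0) (c 1) p := by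
  rw [Fin.sum_univ_five]
  ext
  all_goals
    simp [burgersFields, burgersV1, burgersV2, burgersV3, burgersV4, burgersV5, burgersField]
  all_goals ring

/-- On an open set the identity may be differentiated along `V₁`. At a single point, `τ` and its
`T`-derivatives then give `c₁, c₂, c₄`, and `ξ` and `ξ_T` give `c₅, c₃`. -/
lemma eq_zero_of_burgersField_eq_zero {a α β : ℝ} (ha : a ≠ 0) (hα : α ≠ 0) (hβ : β ≠ 0)
    {Ω : Set (ℝ × ℝ × ℝ)} (hΩ : IsOpen Ω) (hne : Ω.Nonempty) (hpos : Ω ⊆ positiveRegion)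
    {c₁ c₂ c₃ c₄ c₅ : ℝ} (h : ∀ p ∈ Ω, burgersField a α β c₁ c₂ c₃ c₄ c₅ p = 0) :
    c₁ = 0 ∧ c₂ = 0 ∧ c₃ = 0 ∧ c₄ = 0 ∧ c₅ = 0 := by
  have hat : ∀ p ∈ Ω, quadPoly α β c₄ (-2 * c₂) 0 0 c₁ 0 0 p = 0 ∧
      quadPoly α β c₅ (a * c₃) (-c₂) 0 0 c₁ 0 p = 0 := fun p hp => by
    have := (eq_burgersField_iff (V := fun _ => 0) ha hα hβ c₁ c₂ c₃ c₄ c₅ (hpos hp)).1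
      (h p hp).symm
    constructor
    · rw [← this.1]
      simp [tauHat]
    · rw [← this.2.1]
      simp [xiHat]
  have d1 : ∀ {k₀ k₁ k₂ k₃ k₄ k₅ k₆ : ℝ}, (∀ p ∈ Ω, quadPoly α β k₀ k₁ k₂ k₃ k₄ k₅ k₆ p = 0) →
      ∀ p ∈ Ω, quadPoly α β k₁ (2 * k₄) k₅ k₆ 0 0 0 p = 0 := fun h p hp =>
    (fieldDeriv_burgersV1_quadPoly _ _ _ _ _ _ _ hβ (hpos hp)).symm.trans
      (fieldDeriv_eq_zero hΩ h p hp)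
  obtain ⟨p, hp⟩ := hne
  have t0 := (hat p hp).1
  have t1 := d1 (fun q hq => (hat q hq).1) p hp
  have t2 := d1 (d1 fun q hq => (hat q hq).1) p hp
  have x0 := (hat p hp).2
  have x1 := d1 (fun q hq => (hat q hq).2) p hp
  have h1 : c₁ = 0 := by simpa [quadPoly] using t2
  have h2 : c₂ = 0 := by simpa [quadPoly, h1] using t1
  have h3 : c₃ = 0 := by simpa [quadPoly, h1, h2, ha] using x1
  have h4 : c₄ = 0 := by simpa [quadPoly, h1, h2] using t0
  have h5 : c₅ = 0 := by simpa [quadPoly, h1, h2, h3] using x0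
  exact ⟨h1, h2, h3, h4, h5⟩

lemma linearIndependent_domRestrict_burgersFields {a α β : ℝ} (ha : a ≠ 0) (hα : α ≠ 0)
    (hβ : β ≠ 0) {Ω : Set (ℝ × ℝ × ℝ)} (hΩ : IsOpen Ω) (hne : Ω.Nonempty)
    (hpos : Ω ⊆ positiveRegion) :
    LinearIndependent ℝ (fun i => Ω.domRestrict (burgersFields a α β i)) := by
  rw [Fintype.linearIndependent_iff]
  intro c hc
  obtain ⟨h1, h2, h3, h4, h5⟩ := eq_zero_of_burgersField_eq_zero ha hα hβ hΩ hne hpos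
    (c₁ := c 4) (c₂ := c 3) (c₃ := c 2) (c₄ := c 0) (c₅ := c 1) fun p hp => by
      rw [← sum_smul_burgersFields]
      simpa using congrFun hc ⟨p, hp⟩
  intro i
  fin_cases i <;> assumption

/-! ### The classical case. -/

lemma conformableDeriv_one (f : ℝ → ℝ) (t : ℝ) : conformableDeriv 1 f t = deriv f t := by
  have := deriv_comp_const_add f t 0
  simpa [conformableDeriv] using this

/-- At order one every weight is `1` and every correction carries a factor `1 - α` or `1 - β`, so
the two criteria agree term by term, for any `Δ`. -/
lemma isLieSymmetry_one_one_iff (Δ : (Fin 6 → ℝ) → ℝ) (Ω : Set (ℝ × ℝ × ℝ)) (V : PointField) :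
    IsLieSymmetry Δ 1 1 Ω V ↔ IsClassicalLieSymmetry Δ Ω V := by
  have hT : ∀ g, fracPartialT 1 g = partialT g := fun g => by
    ext
    exact conformableDeriv_one _ _
  have hX : ∀ g, fracPartialX 1 g = partialX g := fun g => by
    ext
    exact conformableDeriv_one _ _
  have hjet : ∀ u t x, fracJet 1 1 u t x =
      ![t, x, u t x, partialT u t x, partialX u t x, partialX (partialX u) t x] := fun u t x => by
    simp only [fracJet, hT, hX]
  have hpr : ∀ u t x, fracProlongation 1 1 V u t x =
      ![tauAlong V u t x, xiAlong V u t x, etaAlong V u t x, etaT V u t x, etaX V u t x,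
        etaXX V u t x] := fun u t x => by
    simp [fracProlongation, fracEtaT, fracEtaX, fracEtaXX]
  simp only [IsLieSymmetry, IsClassicalLieSymmetry, hjet, hpr]

end

theorem mainTheorem3 (a b α β : ℝ) (ha : a ≠ 0) (hb : b ≠ 0)
    (hα : 0 < α) (hα1 : α ≤ 1) (hβ : 0 < β) (hβ1 : β ≤ 1)
    (Ω : Set (ℝ × ℝ × ℝ)) (hΩ : IsOpen Ω) (hΩc : IsConnected Ω)
    (hΩpos : ∀ p ∈ Ω, 0 < p.1 ∧ 0 < p.2.1) :
    -- the general infinitesimal symmetry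
    (∀ V : PointField, IsLieSymmetry (burgers a b) α β Ω V ↔
      ∃ c₁ c₂ c₃ c₄ c₅ : ℝ, ∀ t x u : ℝ, (t, x, u) ∈ Ω → V (t, x, u) =
        (c₁ * t ^ (1 + β) / β ^ 2 - 2 * c₂ * t / β + c₄ * t ^ (1 - β),
         c₁ * x * t ^ β / (α * β) - c₂ * x / α + a * c₃ / β * t ^ β * x ^ (1 - α)
           + c₅ * x ^ (1 - α),
         (-c₁ * t ^ β / β + c₂) * u + (c₁ * x ^ α / (a * α) + c₃))) ∧
    -- the symmetries on `Ω` are the span of the five fields, and have dimension five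
    {W : Ω → ℝ × ℝ × ℝ | ∃ V : PointField, IsLieSymmetry (burgers a b) α β Ω V ∧
        Ω.domRestrict V = W} =
      (Submodule.span ℝ (Set.range fun i => Ω.domRestrict (burgersFields a α β i)) :
        Set (Ω → ℝ × ℝ × ℝ)) ∧
    LinearIndependent ℝ (fun i => Ω.domRestrict (burgersFields a α β i)) ∧
    Module.finrank ℝ
      (Submodule.span ℝ (Set.range fun i => Ω.domRestrict (burgersFields a α β i))) = 5 ∧
    -- they are closed under the Lie bracket, with the following commutators
    (∀ V W : PointField, IsLieSymmetry (burgers a b) α β Ω V →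
      IsLieSymmetry (burgers a b) α β Ω W →
      IsLieSymmetry (burgers a b) α β Ω (VectorField.lieBracket ℝ V W)) ∧
    (∀ p ∈ Ω,
      VectorField.lieBracket ℝ (burgersV1 β) (burgersV2 α) p = 0 ∧
      VectorField.lieBracket ℝ (burgersV2 α) (burgersV3 a α β) p = 0 ∧
      VectorField.lieBracket ℝ (burgersV3 a α β) (burgersV5 a α β) p = 0 ∧
      VectorField.lieBracket ℝ (burgersV2 α) (burgersV4 α β) p = -burgersV2 α p ∧
      VectorField.lieBracket ℝ (burgersV2 α) (burgersV5 a α β) p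
        = (1 / a) • burgersV3 a α β p ∧
      VectorField.lieBracket ℝ (burgersV1 β) (burgersV3 a α β) p = a • burgersV2 α p ∧
      VectorField.lieBracket ℝ (burgersV1 β) (burgersV4 α β) p = (-2 : ℝ) • burgersV1 β p ∧
      VectorField.lieBracket ℝ (burgersV1 β) (burgersV5 a α β) p = -burgersV4 α β p ∧
      VectorField.lieBracket ℝ (burgersV3 a α β) (burgersV4 α β) p = burgersV3 a α β p ∧
      VectorField.lieBracket ℝ (burgersV4 α β) (burgersV5 a α β) p
        = (-2 : ℝ) • burgersV5 a α β p) ∧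
    -- reduction to the classical Burgers equation and its symmetries
    (α = 1 → β = 1 →
      (∀ V : PointField, IsLieSymmetry (burgers a b) α β Ω V ↔
        IsClassicalLieSymmetry (burgers a b) Ω V) ∧
      ∀ i : Fin 5, ∀ p ∈ Ω, burgersFields a α β i p = classicalBurgersFields a i p) := by

  have hpos : Ω ⊆ positiveRegion := hΩpos
  have hiff := isLieSymmetry_burgers_iff_exists ha hb hα hβ hΩ hΩc.isPreconnected hpos
  have hli := linearIndependent_domRestrict_burgersFields ha hα.ne' hβ.ne' hΩ hΩc.nonempty hpos
  refine ⟨fun V => ?_, ?_, hli, ?_, fun V W hV hW => ?_, fun p hp => ?_, ?_⟩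
  · rw [hiff V]
    exact ⟨fun ⟨c₁, c₂, c₃, c₄, c₅, h⟩ => ⟨c₁, c₂, c₃, c₄, c₅, fun t x u hp => h hp⟩,
      fun ⟨c₁, c₂, c₃, c₄, c₅, h⟩ => ⟨c₁, c₂, c₃, c₄, c₅, fun p hp => h p.1 p.2.1 p.2.2 hp⟩⟩
  · ext W
    rw [SetLike.mem_coe, Submodule.mem_span_range_iff_exists_fun]
    constructor
    · rintro ⟨V, hV, rfl⟩
      obtain ⟨c₁, c₂, c₃, c₄, c₅, h⟩ := (hiff V).1 hV
      refine ⟨![c₄, c₅, c₃, c₂, c₁], funext fun p => ?_⟩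
      have := sum_smul_burgersFields a α β ![c₄, c₅, c₃, c₂, c₁] p
      rw [Set.domRestrict_apply, h p.2]
      simpa [Finset.sum_apply] using this
    · rintro ⟨c, rfl⟩
      refine ⟨burgersField a α β (c 4) (c 3) (c 2) (c 0) (c 1),
        (hiff _).2 ⟨_, _, _, _, _, fun p _ => rfl⟩, funext fun p => ?_⟩
      simpa [Finset.sum_apply] using (sum_smul_burgersFields a α β c p).symm
  · rw [finrank_span_eq_card hli, Fintype.card_fin]
  · obtain ⟨c₁, c₂, c₃, c₄, c₅, hc⟩ := (hiff V).1 hV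
    obtain ⟨d₁, d₂, d₃, d₄, d₅, hd⟩ := (hiff W).1 hW
    -- The bracket at `p` depends only on the germs there, so agreement with the explicit fields on
    -- the open set `Ω` suffices.
    exact (hiff _).2 ⟨_, _, _, _, _, fun p hp =>
      ((hc.eventuallyEq_of_mem (hΩ.mem_nhds hp)).lieBracket_vectorField_eq
        (hd.eventuallyEq_of_mem (hΩ.mem_nhds hp))).trans
      (lieBracket_burgersField ha hα.ne' hβ.ne' c₁ c₂ c₃ c₄ c₅ d₁ d₂ d₃ d₄ d₅ (hpos hp))⟩
  · have hbr := fun c₁ c₂ c₃ c₄ c₅ d₁ d₂ d₃ d₄ d₅ =>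
      lieBracket_burgersField ha hα.ne' hβ.ne' c₁ c₂ c₃ c₄ c₅ d₁ d₂ d₃ d₄ d₅ (hpos hp)
    simp only [burgersV1_eq a α β, burgersV2_eq a α β, burgersV3_eq a α β, burgersV4_eq a α β,
      burgersV5_eq a α β, hbr]
    refine ⟨?_, ?_, ?_, ?_, ?_, ?_, ?_, ?_, ?_, ?_⟩
    all_goals
      ext
      all_goals
        simp [burgersField]
    all_goals ring
  · rintro rfl rfl
    refine ⟨isLieSymmetry_one_one_iff _ Ω, fun i p hp => ?_⟩
    obtain ⟨t, x, u⟩ := p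
    fin_cases i <;> simp [burgersFields, burgersV1, burgersV2, burgersV3, burgersV4, burgersV5,
      classicalBurgersFields, one_add_one_eq_two]
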